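/- **Model.** Let $K\ge 2$ and $A,B,\tau>0$ with $KA\le B<1$ and $\tau\le (1-B)/K$. Let $\mathcal A$ be a finite set carrying a probability measure $\mathcal Q$ (every subset being measurable). For each $u\in\mathcal A$ let $S_1(u),\dots,S_K(u):[0,1]\to[0,1]$ be similarities with ratios $a(i,u)$, such that $a(i,u)\ge A$ for all $i$, $\sum_i a(i,u)\le B$, and $\operatorname{dist}(S_i(u)[0,1],S_j(u)[0,1])\ge\tau$ for $i\ne j$. Let $\mathcal W=\{p\in\mathbb R^K: p_i\ge 0,\ \sum_i p_i=1\}$. A *choice of independent probabilities* is a Borel probability measure $\mathcal R$ on $\mathcal W$ such that for some $t>0$ one has $\int p_i^{-t}\,d\mathcal R(p)<\infty$ for all $i$ (with $0^{-t}=\infty$). Put $\mathbb P=\mathcal Q\times\mathcal R$ on $\Lambda=\mathcal A\times\mathcal W$; for $\lambda=(u,p)\in\Lambda$ write $a(i,\lambda)=a(i,u)$ and $p(i,\lambda)=p_i$. For $\boldsymbol\lambda=(\lambda_n)_{n\ge1}\in\Lambda^{\mathbb N}$ with law $\mathbb P^{\mathbb N}$ and $\lambda_n=(u_n,p^{(n)})$,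 let $I_{i_1\dots i_n}=S_{i_1}(u_1)\circ\cdots\circ S_{i_n}(u_n)[0,1]$, let $F_{\boldsymbol\lambda}=\bigcap_n\bigcup_{i_1,\dots,i_n}I_{i_1\dots i_n}$, and let $\mu_{\boldsymbol\lambda}$ be the Borel probability measure with $\mu_{\boldsymbol\lambda}(I_{i_1\dots i_n})=\prod_{k=1}^n p(i_k,\lambda_k)$ for all $n$ and all $i_1,\dots,i_n$. For $\theta\ge0$ let $m=m(\theta,\lambda)$ (respectively $m'=m'(\theta,\lambda)$) be the least index $j$ at which $a(j,\lambda)^\theta/p(j,\lambda)$ is maximal (respectively minimal), and put $$G(\theta)=\frac{\mathbb E\log p(m,\lambda)}{\mathbb E\log a(m,\lambda)},\qquad G'(\theta)=\frac{\mathbb E\log p(m',\lambda)}{\mathbb E\log a(m',\lambda)}.$$ **Dimensions.** A *dimension function* is $\Phi:(0,1)\to[0,\infty)$ such that $t^{1+\Phi(t)}$ decreases to $0$ as $t\downarrow0$ and, for some $T\in(0,1/2]$ and $C>0$, $(2t)^{1+\Phi(2t)}\le C\,t^{1+\Phi(t)}$ for $0<t<T$. It is *large* if, for all small $t$, $\Phi(t)=H(t)\log|\log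 t|/|\log t|$ with $H(t)\to\infty$ as $t\to0^+$. The upper $\Phi$-dimension $\overline{\dim}_\Phi\mu$ of a Borel probability measure $\mu$ on $[0,1]$ is the infimum of all $d\in\mathbb R$ for which there are $C_1,C_2>0$ with $\mu(B(x,R))/\mu(B(x,r))\le C_2(R/r)^d$ for all $x\in\operatorname{supp}\mu$ and all $0<r<R^{1+\Phi(R)}\le R\le C_1$, $R<1$. The lower $\Phi$-dimension $\underline{\dim}_\Phi\mu$ is the supremum of all $d\in\mathbb R$ for which the same holds with $\ge$ in place of $\le$. Both take values in $[-\infty,\infty]$. **Theorem.** There is a unique $D\ge0$ with $\mathbb E_{\mathcal Q}\log\sum_{i=1}^K a(i,u)^D=0$, and $\dim_H F_{\boldsymbol\lambda}=D$ almost surely. Moreover: 1. Suppose there are $i\in\{1,\dots,K\}$ and $j,j'\in\mathcal A$ with $\mathcal Q(\{j\})>0$, $\mathcal Q(\{j'\})>0$ and $$\frac{a(i,j)^D}{\sum_{\ell}a(\ell,j)^D}\ne\frac{a(i,j')^D}{\sum_{\ell}a(\ell,j')^D}.$$ Then there are $\delta_1,\delta_2>0$ such that for every choice $\mathcal R$ of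 independent probabilities $G(D)-D>\delta_1$ and $D-G'(D)>\delta_2$, and, almost surely, $\overline{\dim}_\Phi\mu_{\boldsymbol\lambda}>D+\delta_1$ and $\underline{\dim}_\Phi\mu_{\boldsymbol\lambda}<D-\delta_2$ for all large dimension functions $\Phi$. 2. If there is no such triple $(i,j,j')$, then there is a single probability vector $p\in\mathcal W$ with all $p_i>0$ such that, for the independent choice $\mathcal R=\delta_p$, $G(D)=D=G'(D)$ and, almost surely, $\overline{\dim}_\Phi\mu_{\boldsymbol\lambda}=\underline{\dim}_\Phi\mu_{\boldsymbol\lambda}=D$ for all large dimension functions $\Phi$. -/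

import Mathlib

open MeasureTheory Filter Topology

/-! ### Dimension functions and the upper and lower `Φ`-dimensions of a measure -/

/-- A dimension function `Φ : (0,1) → [0,∞)`: `t ^ (1 + Φ t)` decreases to `0` as `t` decreases to
`0`, and is doubling near zero. Only the values of `Φ` on `(0,1)` matter. -/
structure IsDimensionFunction (Φ : ℝ → ℝ) : Prop where
  nonneg : ∀ t ∈ Set.Ioo (0 : ℝ) 1, 0 ≤ Φ t
  mono : MonotoneOn (fun t : ℝ => t ^ (1 + Φ t)) (Set.Ioo 0 1)
  tendsto_zero : Tendsto (fun t : ℝ => t ^ (1 + Φ t)) (𝓝[>] 0) (𝓝 0)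
  doubling : ∃ T C : ℝ, 0 < T ∧ T ≤ 1 / 2 ∧ 0 < C ∧
    ∀ t : ℝ, 0 < t → t < T → (2 * t) ^ (1 + Φ (2 * t)) ≤ C * t ^ (1 + Φ t)

/-- A large dimension function: `Φ t = H t * log |log t| / |log t|` with `H t → ∞` as `t → 0+`.
The identity is required for small `t` only: at `t = 1/e` its right side vanishes, which would
exclude the constants. -/
structure IsLargeDimensionFunction (Φ : ℝ → ℝ) : Prop extends IsDimensionFunction Φ where
  large : ∃ H : ℝ → ℝ, Tendsto H (𝓝[>] 0) atTop ∧
    ∀ᶠ t in 𝓝[>] (0 : ℝ), Φ t = H t * (Real.log |Real.log t| / |Real.log t|)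

section PhiDimension

variable {X : Type*} [PseudoMetricSpace X] [MeasurableSpace X]

/-- The upper `Φ`-dimension of the measure `μ` (the infimum of the empty set is `∞`). -/
noncomputable def upperPhiDim (Φ : ℝ → ℝ) (μ : Measure X) : EReal :=
  sInf {e : EReal | ∃ d : ℝ, e = (d : EReal) ∧ ∃ C₁ C₂ : ℝ, 0 < C₁ ∧ 0 < C₂ ∧
    ∀ r R : ℝ, 0 < r → r < R ^ (1 + Φ R) → R ^ (1 + Φ R) ≤ R → R ≤ C₁ → 0 < R → R < 1 →
      ∀ x ∈ μ.support,
        μ.real (Metric.ball x R) / μ.real (Metric.ball x r) ≤ C₂ * (R / r) ^ d}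

/-- The lower `Φ`-dimension of the measure `μ`. -/
noncomputable def lowerPhiDim (Φ : ℝ → ℝ) (μ : Measure X) : EReal :=
  sSup {e : EReal | ∃ d : ℝ, e = (d : EReal) ∧ ∃ C₁ C₂ : ℝ, 0 < C₁ ∧ 0 < C₂ ∧
    ∀ r R : ℝ, 0 < r → r < R ^ (1 + Φ R) → R ^ (1 + Φ R) ≤ R → R ≤ C₁ → 0 < R → R < 1 →
      ∀ x ∈ μ.support,
        C₂ * (R / r) ^ d ≤ μ.real (Metric.ball x R) / μ.real (Metric.ball x r)}

end PhiDimension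

/-! ### The random model -/

/-- A family, indexed by `𝒜`, of uniformly strongly separated iterated function systems, each
consisting of `K` similarities `S u i` of `[0,1]` with scaling ratios `a u i`. -/
structure IFSFamily (𝒜 : Type*) (K : ℕ) where
  A : ℝ
  B : ℝ
  τ : ℝ
  S : 𝒜 → Fin K → unitInterval → unitInterval
  a : 𝒜 → Fin K → ℝ
  two_le : 2 ≤ K
  A_pos : 0 < A
  mul_A_le : (K : ℝ) * A ≤ B
  B_lt_one : B < 1
  τ_pos : 0 < τ
  τ_le : τ ≤ (1 - B) / K
  similarity : ∀ u i x y, dist (S u i x) (S u i y) = a u i * dist x y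
  A_le : ∀ u i, A ≤ a u i
  sum_le : ∀ u, ∑ i, a u i ≤ B
  separated : ∀ u i j, i ≠ j → ∀ x y, τ ≤ dist (S u i x) (S u j y)

/-- The space of probability weight vectors with `K` entries. -/
abbrev Weights (K : ℕ) : Type := stdSimplex ℝ (Fin K)

/-- The moment condition on a distribution `ℛ` of weight vectors: for some `t > 0`, the expectation
of `p i ^ (-t)` is finite for all `i` (with `0 ^ (-t) = ∞`). -/
def FiniteNegMoment {K : ℕ} (ℛ : Measure (Weights K)) : Prop :=
  ∃ t : ℝ, 0 < t ∧ ∀ i, ∫⁻ p : Weights K, ENNReal.ofReal (p.1 i) ^ (-t) ∂ℛ < ⊤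

/-- The probability measure on `{1, …, K}` with weights `p`. -/
noncomputable def weightPMF {K : ℕ} (p : Weights K) : PMF (Fin K) :=
  PMF.ofFintype (fun i => ENNReal.ofReal (p.1 i)) (by
    rw [← ENNReal.ofReal_sum_of_nonneg (fun i _ => p.2.1 i), p.2.2, ENNReal.ofReal_one])

namespace IFSFamily

variable {𝒜 : Type*} {K : ℕ} (M : IFSFamily 𝒜 K)

/-- The composition `S_{i₁}(u₁) ∘ ⋯ ∘ S_{iₙ}(uₙ)` (indices start at `0` here). -/
def comp (u : ℕ → 𝒜) (i : ℕ → Fin K) : ℕ → unitInterval → unitInterval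
  | 0 => id
  | n + 1 => comp u i n ∘ M.S (u n) (i n)

/-- The step `n` Moran interval `I_{i₁,…,iₙ}`. -/
def moranInterval (u : ℕ → 𝒜) (i : ℕ → Fin K) (n : ℕ) : Set unitInterval :=
  Set.range (M.comp u i n)

/-- The Moran set `F = ⋂ₙ ⋃_{i₁,…,iₙ} I_{i₁,…,iₙ}`. -/
def moranSet (u : ℕ → 𝒜) : Set unitInterval :=
  ⋂ n : ℕ, ⋃ i : ℕ → Fin K, M.moranInterval u i n

/-- The point of the Moran set with address `i`, that is, the only point of `⋂ₙ I_{i₁,…,iₙ}`. -/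
noncomputable def codingPoint (u : ℕ → 𝒜) (i : ℕ → Fin K) : unitInterval :=
  limUnder atTop (fun n => M.comp u i n 0)

/-- The measure `μ` determined by `μ [0,1] = 1` and `μ I_{ν,j} = μ I_ν * p(j, λ_{n+1})`: the image
under the coding map of the product, over `n`, of the weights chosen at step `n`. -/
noncomputable def moranMeasure (ω : ℕ → 𝒜 × Weights K) : Measure unitInterval :=
  (Measure.infinitePi fun n => (weightPMF (ω n).2).toMeasure).map
    (M.codingPoint fun n => (ω n).1)

/-- The indices at which `a_j ^ θ / p_j` is maximal. -/
noncomputable def maxIndices (θ : ℝ) (x : 𝒜 × Weights K) : Finset (Fin K) :=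
  open Classical in Finset.univ.filter fun m =>
    ∀ j, M.a x.1 j ^ θ / x.2.1 j ≤ M.a x.1 m ^ θ / x.2.1 m

/-- The indices at which `a_j ^ θ / p_j` is minimal. -/
noncomputable def minIndices (θ : ℝ) (x : 𝒜 × Weights K) : Finset (Fin K) :=
  open Classical in Finset.univ.filter fun m =>
    ∀ j, M.a x.1 m ^ θ / x.2.1 m ≤ M.a x.1 j ^ θ / x.2.1 j

theorem maxIndices_nonempty (θ : ℝ) (x : 𝒜 × Weights K) : (M.maxIndices θ x).Nonempty := by
  have : NeZero K := ⟨by have := M.two_le; omega⟩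
  obtain ⟨m, hm⟩ := Finite.exists_max fun j => M.a x.1 j ^ θ / x.2.1 j
  exact ⟨m, by simpa [maxIndices] using hm⟩

theorem minIndices_nonempty (θ : ℝ) (x : 𝒜 × Weights K) : (M.minIndices θ x).Nonempty := by
  have : NeZero K := ⟨by have := M.two_le; omega⟩
  obtain ⟨m, hm⟩ := Finite.exists_min fun j => M.a x.1 j ^ θ / x.2.1 j
  exact ⟨m, by simpa [minIndices] using hm⟩

/-- `m(θ, λ)`: the minimal index at which `a_j ^ θ / p_j` is maximal. -/
noncomputable def m (θ : ℝ) (x : 𝒜 × Weights K) : Fin K :=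
  (M.maxIndices θ x).min' (M.maxIndices_nonempty θ x)

/-- `m'(θ, λ)`: the minimal index at which `a_j ^ θ / p_j` is minimal. -/
noncomputable def m' (θ : ℝ) (x : 𝒜 × Weights K) : Fin K :=
  (M.minIndices θ x).min' (M.minIndices_nonempty θ x)

variable [MeasurableSpace 𝒜]

/-- `G(θ) = 𝔼 log p(m) / 𝔼 log a(m)` with `m = m(θ, λ)`. -/
noncomputable def G (P : Measure (𝒜 × Weights K)) (θ : ℝ) : ℝ :=
  (∫ x, Real.log (x.2.1 (M.m θ x)) ∂P) / ∫ x, Real.log (M.a x.1 (M.m θ x)) ∂P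

/-- `G'(θ) = 𝔼 log p(m') / 𝔼 log a(m')` with `m' = m'(θ, λ)`. -/
noncomputable def G' (P : Measure (𝒜 × Weights K)) (θ : ℝ) : ℝ :=
  (∫ x, Real.log (x.2.1 (M.m' θ x)) ∂P) / ∫ x, Real.log (M.a x.1 (M.m' θ x)) ∂P

/-- `x ≥ 0` solves `𝔼 log (a_1 ^ x + ⋯ + a_K ^ x) = 0`. -/
def IsMoranRoot (𝒬 : Measure 𝒜) (x : ℝ) : Prop :=
  0 ≤ x ∧ ∫ u, Real.log (∑ i, M.a u i ^ x) ∂𝒬 = 0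

end IFSFamily

/-!
Everything is read off from addresses. Write `|I_n|` for the length of a Moran interval (`len`). Two
points of the Moran set whose addresses first differ at step `n` have distance between `τ |I_n|` and
`|I_n|`, so a ball of radius `τ |I_n|` carries at most the mass of `I_n`, and a ball of radius
larger than `|I_n|` at least that mass (`measureReal_ball_le`, `le_measureReal_ball`).

*The Hausdorff dimension.* The covers by the intervals of step `n` have `s`-sum
`exp (∑ k < n, log ∑ l, a(l, u_k) ^ s)`, whose exponent has negative mean when `s > D`; the weights
`a_i ^ D / ∑ l, a_l ^ D` (`normWeight`) give a measure with `μ I_n = |I_n| ^ D * exp (-S_n)`, where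
`S_n = ∑ k < n, log ∑ l, a(l, u_k) ^ D` is `o(n)`, and the mass distribution principle applies.

*The gap.* For any dimension function, letting `r → 0` with `R` fixed shows that the upper
`Φ`-dimension is at least, and the lower one at most, any local dimension of the measure at a point
of the support. At the points whose addresses are chosen by `m` and `m'`, the strong law of large
numbers identifies the local dimensions as `G D` and `G' D` (`ae_phiDim_bounds`). Because
`𝔼 log ∑ l, a_l ^ D = 0`, the difference `G D - D` equals `𝔼 log (w_m / p_m) / |𝔼 log a_m|`, where
`w = normWeight D u`; the maximal ratio of two probability vectors controls their distance
(`abs_sub_le_neg_log`), and likewise for the minimal ratio. Since `p` is independent of `u`, it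
cannot be close to two different vectors `w`, which bounds both gaps uniformly
(`exists_uniform_gap`).

*Equality.* If `w` is almost surely constant, take `p = w`. A ball of radius `R` has mass comparable
with `R ^ D * exp (-S_n)`, where `n` is the step of scale `R`. For a large dimension function and
`r < R ^ (1 + Φ R)`, the steps `n ≤ N` of `R` and `r` differ by more than any multiple of `log n`
(`exists_step_gap`), and by Hoeffding's inequality and the Borel-Cantelli lemma almost surely
`|S_N - S_n| ≤ ε (N - n)` for all such pairs with `n` large (`ae_block_average_le`). Hence the mass
ratios are `(R / r) ^ D` up to factors `(R / r) ^ (± ε)`.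
-/

/-! ### Geometry of the coding map -/

namespace IFSFamily

variable {𝒜 : Type*} {K : ℕ} (M : IFSFamily 𝒜 K)

theorem a_pos (u : 𝒜) (i : Fin K) : 0 < M.a u i := M.A_pos.trans_le (M.A_le u i)

theorem a_le_B (u : 𝒜) (i : Fin K) : M.a u i ≤ M.B :=
  (Finset.single_le_sum (fun j _ => (M.a_pos u j).le) (Finset.mem_univ i)).trans (M.sum_le u)

theorem B_pos : 0 < M.B :=
  lt_of_lt_of_le (mul_pos (Nat.cast_pos.2 (by have := M.two_le; omega)) M.A_pos) M.mul_A_le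

theorem A_le_B : M.A ≤ M.B := by
  have hK : (2 : ℝ) ≤ K := by exact_mod_cast M.two_le
  nlinarith [M.mul_A_le, M.A_pos]

theorem A_lt_one : M.A < 1 := M.A_le_B.trans_lt M.B_lt_one

theorem a_lt_one (u : 𝒜) (i : Fin K) : M.a u i < 1 := (M.a_le_B u i).trans_lt M.B_lt_one

theorem log_A_le (u : 𝒜) (i : Fin K) : Real.log M.A ≤ Real.log (M.a u i) :=
  Real.log_le_log M.A_pos (M.A_le u i)

theorem log_a_le (u : 𝒜) (i : Fin K) : Real.log (M.a u i) ≤ Real.log M.B :=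
  Real.log_le_log (M.a_pos u i) (M.a_le_B u i)

/-- The length of the Moran interval `I_{i₁,…,iₙ}`. -/
noncomputable def len (u : ℕ → 𝒜) (i : ℕ → Fin K) (n : ℕ) : ℝ :=
  ∏ k ∈ Finset.range n, M.a (u k) (i k)

variable (u : ℕ → 𝒜)

theorem len_pos (i : ℕ → Fin K) (n : ℕ) : 0 < M.len u i n :=
  Finset.prod_pos fun _ _ => M.a_pos _ _

@[simp] theorem len_zero (i : ℕ → Fin K) : M.len u i 0 = 1 := by simp [len]

theorem len_succ (i : ℕ → Fin K) (n : ℕ) :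
    M.len u i (n + 1) = M.len u i n * M.a (u n) (i n) := Finset.prod_range_succ _ _

theorem len_add_le (i : ℕ → Fin K) (n k : ℕ) :
    M.len u i (n + k) ≤ M.B ^ k * M.len u i n := by
  induction k with
  | zero => simp
  | succ k ih =>
    rw [← add_assoc, len_succ, pow_succ]
    calc _ ≤ (M.B ^ k * M.len u i n) * M.B :=
          mul_le_mul ih (M.a_le_B _ _) (M.a_pos _ _).le
            (mul_nonneg (pow_nonneg M.B_pos.le _) (M.len_pos u i n).le)
      _ = _ := by ring

theorem le_len_add (i : ℕ → Fin K) (n k : ℕ) :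
    M.A ^ k * M.len u i n ≤ M.len u i (n + k) := by
  induction k with
  | zero => simp
  | succ k ih =>
    rw [← add_assoc, len_succ, pow_succ]
    calc M.A ^ k * M.A * M.len u i n = (M.A ^ k * M.len u i n) * M.A := by ring
      _ ≤ _ := mul_le_mul ih (M.A_le _ _) M.A_pos.le (M.len_pos _ _ _).le

theorem len_le (i : ℕ → Fin K) (n : ℕ) : M.len u i n ≤ M.B ^ n := by
  simpa using M.len_add_le u i 0 n

theorem len_antitone (i : ℕ → Fin K) : Antitone (M.len u i) :=
  antitone_nat_of_succ_le fun n => by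
    rw [len_succ]
    exact mul_le_of_le_one_right (M.len_pos u i n).le (M.a_lt_one _ _).le

theorem comp_congr {i j : ℕ → Fin K} {n : ℕ} (h : ∀ k < n, i k = j k) :
    M.comp u i n = M.comp u j n := by
  induction n with
  | zero => rfl
  | succ n ih => rw [comp, comp, ih fun k hk => h k (hk.trans n.lt_succ_self), h n n.lt_succ_self]

theorem dist_comp (i : ℕ → Fin K) (n : ℕ) (x y : unitInterval) :
    dist (M.comp u i n x) (M.comp u i n y) = M.len u i n * dist x y := by
  induction n generalizing x y with
  | zero => simp [comp]
  | succ n ih => simp only [comp, Function.comp_apply, ih, M.similarity, len_succ]; ring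

theorem lipschitzWith_S (v : 𝒜) (i : Fin K) : LipschitzWith 1 (M.S v i) :=
  LipschitzWith.of_dist_le_mul fun x y => by
    rw [M.similarity]
    simpa using mul_le_mul_of_nonneg_right (M.a_lt_one v i).le dist_nonneg

theorem continuous_comp (i : ℕ → Fin K) (n : ℕ) : Continuous (M.comp u i n) := by
  induction n with
  | zero => exact continuous_id
  | succ n ih => exact ih.comp (M.lipschitzWith_S _ _).continuous

theorem unitInterval_dist_le_one (x y : unitInterval) : dist x y ≤ 1 :=
  Real.dist_le_of_mem_Icc_01 x.2 y.2

theorem moranInterval_antitone (i : ℕ → Fin K) : Antitone (M.moranInterval u i) :=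
  antitone_nat_of_succ_le fun n => by
    rw [moranInterval, comp]
    exact Set.range_comp_subset_range _ _

theorem tendsto_codingPoint (i : ℕ → Fin K) :
    Tendsto (fun n => M.comp u i n 0) atTop (𝓝 (M.codingPoint u i)) := by
  refine CauchySeq.tendsto_limUnder (cauchySeq_of_le_geometric M.B 1 M.B_lt_one fun n => ?_)
  rw [comp, Function.comp_apply, dist_comp, one_mul]
  exact (mul_le_of_le_one_right (M.len_pos u i n).le (unitInterval_dist_le_one _ _)).trans
    (M.len_le u i n)

theorem codingPoint_mem (i : ℕ → Fin K) (n : ℕ) : M.codingPoint u i ∈ M.moranInterval u i n := by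
  refine (isCompact_range (M.continuous_comp u i n)).isClosed.mem_of_tendsto
    (M.tendsto_codingPoint u i) (eventually_atTop.2 ⟨n, fun k hk => ?_⟩)
  exact M.moranInterval_antitone u i hk ⟨0, rfl⟩

theorem codingPoint_mem_moranSet (i : ℕ → Fin K) : M.codingPoint u i ∈ M.moranSet u :=
  Set.mem_iInter.2 fun n => Set.mem_iUnion.2 ⟨i, M.codingPoint_mem u i n⟩

theorem dist_codingPoint_le {i j : ℕ → Fin K} {n : ℕ} (h : ∀ k < n, i k = j k) :
    dist (M.codingPoint u i) (M.codingPoint u j) ≤ M.len u i n := by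
  obtain ⟨x, hx⟩ := M.codingPoint_mem u i n
  obtain ⟨y, hy⟩ := M.codingPoint_mem u j n
  rw [← hx, ← hy, ← M.comp_congr u h, dist_comp]
  exact mul_le_of_le_one_right (M.len_pos u i n).le (unitInterval_dist_le_one _ _)

/-- Strong separation: addresses which differ for the first time at step `n` code points whose
distance is at least `τ` times the length of the last common Moran interval. -/
theorem le_dist_codingPoint {i j : ℕ → Fin K} {n : ℕ} (h : ∀ k < n, i k = j k) (hn : i n ≠ j n) :
    M.τ * M.len u i n ≤ dist (M.codingPoint u i) (M.codingPoint u j) := by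
  obtain ⟨x, hx⟩ := M.codingPoint_mem u i (n + 1)
  obtain ⟨y, hy⟩ := M.codingPoint_mem u j (n + 1)
  rw [← hx, ← hy]
  simp only [comp, Function.comp_apply]
  rw [← M.comp_congr u h, dist_comp, mul_comm]
  exact mul_le_mul_of_nonneg_left (M.separated _ _ _ hn _ _) (M.len_pos u i n).le

theorem continuous_codingPoint : Continuous (M.codingPoint u) := by
  refine continuous_iff_continuousAt.2 fun i => Metric.tendsto_nhds.2 fun ε hε => ?_
  obtain ⟨n, hn⟩ := exists_pow_lt_of_lt_one hε M.B_lt_one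
  have : ∀ᶠ j in 𝓝 i, ∀ k ∈ Finset.range n, j k = i k :=
    (Filter.eventually_all_finset _).2 fun k _ =>
      (continuous_apply k).continuousAt.eventually ((isOpen_discrete {i k}).mem_nhds rfl)
  filter_upwards [this] with j hj
  rw [dist_comm]
  exact ((M.dist_codingPoint_le u fun k hk => (hj k (Finset.mem_range.2 hk)).symm).trans
    (M.len_le u i n)).trans_lt hn

theorem measurable_codingPoint : Measurable (M.codingPoint u) :=
  (M.continuous_codingPoint u).measurable

theorem isCompact_range_codingPoint : IsCompact (Set.range (M.codingPoint u)) :=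
  isCompact_range (M.continuous_codingPoint u)

/-- For every scale `R ≤ τ` there is a step at which the gaps around the Moran interval with
address `i` are comparable with `R`. -/
theorem exists_len_scale (i : ℕ → Fin K) {R : ℝ} (hR : 0 < R) (hRτ : R ≤ M.τ) :
    ∃ n, R ≤ M.τ * M.len u i n ∧ M.τ * M.len u i (n + 1) < R := by
  classical
  have hex : ∃ n, M.τ * M.len u i n < R := by
    obtain ⟨n, hn⟩ := exists_pow_lt_of_lt_one (div_pos hR M.τ_pos) M.B_lt_one
    refine ⟨n, ?_⟩
    rw [lt_div_iff₀ M.τ_pos] at hn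
    nlinarith [M.len_le u i n, M.τ_pos]
  have h0 : Nat.find hex ≠ 0 := by
    intro h
    have := Nat.find_spec hex
    rw [h] at this
    simp only [len_zero, mul_one] at this
    linarith
  obtain ⟨n, hn⟩ := Nat.exists_eq_succ_of_ne_zero h0
  refine ⟨n, not_lt.1 (Nat.find_min hex (by omega)), ?_⟩
  have := Nat.find_spec hex
  rwa [hn] at this

end IFSFamily

/-! ### Masses of Moran intervals and of balls -/

namespace IFSFamily

variable {𝒜 : Type*} {K : ℕ} (M : IFSFamily 𝒜 K)

/-- The mass of the Moran interval `I_{i₁,…,iₙ}`. -/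
noncomputable def mass (ω : ℕ → 𝒜 × Weights K) (i : ℕ → Fin K) (n : ℕ) : ℝ :=
  ∏ k ∈ Finset.range n, (ω k).2.1 (i k)

variable (ω : ℕ → 𝒜 × Weights K)

instance isProbabilityMeasure_moranMeasure : IsProbabilityMeasure (M.moranMeasure ω) :=
  Measure.isProbabilityMeasure_map (M.measurable_codingPoint _).aemeasurable

theorem infinitePi_cylinder (i : ℕ → Fin K) (n : ℕ) :
    (Measure.infinitePi fun n => (weightPMF (ω n).2).toMeasure).real {j | ∀ k < n, j k = i k} =
      mass ω i n := by
  have : {j : ℕ → Fin K | ∀ k < n, j k = i k} = Set.pi (Finset.range n) fun k => {i k} := by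
    ext j; simp
  rw [this, Measure.real, Measure.infinitePi_pi (fun n => (weightPMF (ω n).2).toMeasure)
      fun _ _ => MeasurableSet.singleton _,
    ENNReal.toReal_prod, mass]
  refine Finset.prod_congr rfl fun k _ => ?_
  rw [PMF.toMeasure_apply_singleton _ _ (MeasurableSet.singleton _)]
  simp [weightPMF, ENNReal.toReal_ofReal ((ω k).2.2.1 _)]

theorem moranMeasure_real_ball (x : unitInterval) (R : ℝ) :
    (M.moranMeasure ω).real (Metric.ball x R) =
      (Measure.infinitePi fun n => (weightPMF (ω n).2).toMeasure).real
        {j | dist (M.codingPoint (fun n => (ω n).1) j) x < R} := by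
  rw [moranMeasure, map_measureReal_apply (M.measurable_codingPoint _)
    Metric.isOpen_ball.measurableSet]
  rfl

theorem measureReal_ball_le (i : ℕ → Fin K) {n : ℕ} {R : ℝ}
    (hR : R ≤ M.τ * M.len (fun k => (ω k).1) i n) :
    (M.moranMeasure ω).real (Metric.ball (M.codingPoint (fun k => (ω k).1) i) R) ≤
      mass ω i n := by
  classical
  rw [moranMeasure_real_ball, ← infinitePi_cylinder]
  refine measureReal_mono fun j hj => ?_
  by_contra hne
  have hex : ∃ k, j k ≠ i k := by
    simp only [Set.mem_ofPred_eq, not_forall] at hne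
    obtain ⟨k, -, hk⟩ := hne
    exact ⟨k, hk⟩
  have hlt : Nat.find hex < n := by
    simp only [Set.mem_ofPred_eq, not_forall] at hne
    obtain ⟨k, hkn, hk⟩ := hne
    exact (Nat.find_min' hex hk).trans_lt hkn
  have h1 := M.le_dist_codingPoint (fun k => (ω k).1) (i := i) (j := j) (n := Nat.find hex)
    (fun k hk => (not_not.1 (Nat.find_min hex hk)).symm) (Nat.find_spec hex).symm
  rw [Set.mem_ofPred_eq, dist_comm] at hj
  have h2 := mul_le_mul_of_nonneg_left (M.len_antitone (fun k => (ω k).1) i hlt.le) M.τ_pos.le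
  linarith

theorem le_measureReal_ball (i : ℕ → Fin K) {n : ℕ} {R : ℝ}
    (hR : M.len (fun k => (ω k).1) i n < R) :
    mass ω i n ≤
      (M.moranMeasure ω).real (Metric.ball (M.codingPoint (fun k => (ω k).1) i) R) := by
  rw [moranMeasure_real_ball, ← infinitePi_cylinder]
  refine measureReal_mono fun j hj => ?_
  rw [Set.mem_ofPred_eq, dist_comm]
  exact (M.dist_codingPoint_le _ fun k hk => (hj k hk).symm).trans_lt hR

theorem support_moranMeasure_subset :
    (M.moranMeasure ω).support ⊆ Set.range (M.codingPoint fun n => (ω n).1) := by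
  refine Measure.support_subset_of_isClosed (M.isCompact_range_codingPoint _).isClosed ?_
  rw [mem_ae_iff, moranMeasure, Measure.map_apply (M.measurable_codingPoint _)
    (M.isCompact_range_codingPoint _).isClosed.measurableSet.compl]
  simp

theorem mass_pos {i : ℕ → Fin K} (h : ∀ n, 0 < (ω n).2.1 (i n)) (n : ℕ) : 0 < mass ω i n :=
  Finset.prod_pos fun k _ => h k

theorem measureReal_ball_pos {i : ℕ → Fin K} (h : ∀ n, 0 < (ω n).2.1 (i n)) {R : ℝ} (hR : 0 < R) :
    0 < (M.moranMeasure ω).real (Metric.ball (M.codingPoint (fun k => (ω k).1) i) R) := by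
  obtain ⟨n, hn⟩ := exists_pow_lt_of_lt_one hR M.B_lt_one
  exact (mass_pos ω h n).trans_le (M.le_measureReal_ball ω i ((M.len_le _ _ _).trans_lt hn))

theorem codingPoint_mem_support {i : ℕ → Fin K} (h : ∀ n, 0 < (ω n).2.1 (i n)) :
    M.codingPoint (fun n => (ω n).1) i ∈ (M.moranMeasure ω).support :=
  Metric.nhds_basis_ball.mem_measureSupport.2 fun _ hR =>
    (ENNReal.toReal_pos_iff.1 (M.measureReal_ball_pos ω h hR)).1

end IFSFamily

/-! ### Local dimensions and `Φ`-dimensions -/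

/-- An affine inequality between two sequences passes to the limit of their averages. -/
theorem le_of_tendsto_div {s t : ℕ → ℝ} {x y c d : ℝ}
    (hs : Tendsto (fun n : ℕ => s n / n) atTop (𝓝 x))
    (ht : Tendsto (fun n : ℕ => t n / n) atTop (𝓝 y))
    (h : ∀ᶠ n in atTop, d * t n ≤ s n + c) : d * y ≤ x := by
  have h1 : Tendsto (fun n : ℕ => s n / n + c / n) atTop (𝓝 (x + 0)) :=
    hs.add (tendsto_const_div_atTop_nhds_zero_nat c)
  rw [add_zero] at h1
  refine le_of_tendsto_of_tendsto (ht.const_mul d) h1 ?_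
  filter_upwards [h, eventually_gt_atTop 0] with n hn hn0
  have : (0 : ℝ) < n := Nat.cast_pos.2 hn0
  rw [← add_div, mul_div_assoc']
  gcongr

theorem IsDimensionFunction.rpow_pos_and_le {Φ : ℝ → ℝ} (hΦ : IsDimensionFunction Φ)
    {R : ℝ} (h0 : 0 < R)
    (h1 : R < 1) : 0 < R ^ (1 + Φ R) ∧ R ^ (1 + Φ R) ≤ R := by
  refine ⟨Real.rpow_pos_of_pos h0 _, ?_⟩
  have := Real.rpow_le_rpow_of_exponent_ge h0 h1.le
    (show (1 : ℝ) ≤ 1 + Φ R by linarith [hΦ.nonneg R ⟨h0, h1⟩])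
  simpa using this

namespace IFSFamily

variable {𝒜 : Type*} {K : ℕ} (M : IFSFamily 𝒜 K)

variable (ω : ℕ → 𝒜 × Weights K)

theorem log_len (u : ℕ → 𝒜) (i : ℕ → Fin K) (n : ℕ) :
    Real.log (M.len u i n) = ∑ k ∈ Finset.range n, Real.log (M.a (u k) (i k)) :=
  Real.log_prod fun _ _ => (M.a_pos _ _).ne'

theorem log_mass {i : ℕ → Fin K} (h : ∀ n, 0 < (ω n).2.1 (i n)) (n : ℕ) :
    Real.log (mass ω i n) = ∑ k ∈ Finset.range n, Real.log ((ω k).2.1 (i k)) :=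
  Real.log_prod fun k _ => (h k).ne'

theorem tendsto_len (u : ℕ → 𝒜) (i : ℕ → Fin K) : Tendsto (M.len u i) atTop (𝓝 0) :=
  squeeze_zero (fun n => (M.len_pos u i n).le) (M.len_le u i)
    (tendsto_pow_atTop_nhds_zero_of_lt_one M.B_pos.le M.B_lt_one)

/-- With `R` fixed and `r → 0`, the upper `Φ`-dimension dominates the local dimension at every
point of the support. -/
theorem le_upperPhiDim {i : ℕ → Fin K} (h : ∀ n, 0 < (ω n).2.1 (i n)) {x y : ℝ} (hy0 : y < 0)
    (hx : Tendsto (fun n : ℕ => (∑ k ∈ Finset.range n, Real.log ((ω k).2.1 (i k))) / n) atTop (𝓝 x))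
    (hy : Tendsto (fun n : ℕ => (∑ k ∈ Finset.range n, Real.log (M.a (ω k).1 (i k))) / n)
      atTop (𝓝 y)) {Φ : ℝ → ℝ} (hΦ : IsDimensionFunction Φ) :
    ((x / y : ℝ) : EReal) ≤ upperPhiDim Φ (M.moranMeasure ω) := by
  refine le_sInf ?_
  rintro _ ⟨d, rfl, C₁, C₂, hC₁, hC₂, H⟩
  rw [EReal.coe_le_coe_iff, div_le_iff_of_neg hy0]
  set u : ℕ → 𝒜 := fun k => (ω k).1
  set R : ℝ := min C₁ (1 / 2)
  have hR0 : 0 < R := lt_min hC₁ (by norm_num)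
  have hR1 : R < 1 := (min_le_right _ _).trans_lt (by norm_num)
  obtain ⟨hρ, hρR⟩ := hΦ.rpow_pos_and_le hR0 hR1
  set mR := (M.moranMeasure ω).real (Metric.ball (M.codingPoint u i) R)
  have hmR : 0 < mR := M.measureReal_ball_pos ω h hR0
  have hsmall : ∀ᶠ n in atTop, M.τ * M.len u i n < R ^ (1 + Φ R) := by
    have := (M.tendsto_len u i).const_mul M.τ
    rw [mul_zero] at this
    exact this.eventually (gt_mem_nhds hρ)
  refine le_of_tendsto_div (c := Real.log C₂ - Real.log mR + d * Real.log (R / M.τ)) hx hy ?_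
  filter_upwards [hsmall] with n hn
  have hr : 0 < M.τ * M.len u i n := mul_pos M.τ_pos (M.len_pos u i n)
  have h1 := H _ R hr hn hρR (min_le_left _ _) hR0 hR1 _ (M.codingPoint_mem_support ω h)
  have h2 : mR / mass ω i n ≤ C₂ * (R / (M.τ * M.len u i n)) ^ d :=
    (div_le_div_of_nonneg_left hmR.le (M.measureReal_ball_pos ω h hr)
      (M.measureReal_ball_le ω i le_rfl)).trans h1
  have h3 := Real.log_le_log (div_pos hmR (mass_pos ω h n)) h2
  rw [Real.log_div hmR.ne' (mass_pos ω h n).ne', Real.log_mul hC₂.ne'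
    (Real.rpow_pos_of_pos (div_pos hR0 hr) _).ne', Real.log_rpow (div_pos hR0 hr), ← div_div,
    Real.log_div (div_pos hR0 M.τ_pos).ne' (M.len_pos u i n).ne'] at h3
  rw [← log_mass ω h, ← M.log_len u]
  linarith

/-- With `R` fixed and `r → 0`, the lower `Φ`-dimension is at most the local dimension at every
point of the support. -/
theorem lowerPhiDim_le {i : ℕ → Fin K} (h : ∀ n, 0 < (ω n).2.1 (i n)) {x y : ℝ} (hy0 : y < 0)
    (hx : Tendsto (fun n : ℕ => (∑ k ∈ Finset.range n, Real.log ((ω k).2.1 (i k))) / n) atTop (𝓝 x))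
    (hy : Tendsto (fun n : ℕ => (∑ k ∈ Finset.range n, Real.log (M.a (ω k).1 (i k))) / n)
      atTop (𝓝 y)) {Φ : ℝ → ℝ} (hΦ : IsDimensionFunction Φ) :
    lowerPhiDim Φ (M.moranMeasure ω) ≤ ((x / y : ℝ) : EReal) := by
  refine sSup_le ?_
  rintro _ ⟨d, rfl, C₁, C₂, hC₁, hC₂, H⟩
  rw [EReal.coe_le_coe_iff, le_div_iff_of_neg hy0]
  set u : ℕ → 𝒜 := fun k => (ω k).1
  set R : ℝ := min C₁ (1 / 2)
  have hR0 : 0 < R := lt_min hC₁ (by norm_num)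
  have hR1 : R < 1 := (min_le_right _ _).trans_lt (by norm_num)
  obtain ⟨hρ, hρR⟩ := hΦ.rpow_pos_and_le hR0 hR1
  have hsmall : ∀ᶠ n in atTop, 2 * M.len u i n < R ^ (1 + Φ R) := by
    have := (M.tendsto_len u i).const_mul 2
    rw [mul_zero] at this
    exact this.eventually (gt_mem_nhds hρ)
  suffices -d * y ≤ -x by linarith
  refine le_of_tendsto_div (s := fun n => -∑ k ∈ Finset.range n, Real.log ((ω k).2.1 (i k)))
    (c := -Real.log C₂ - d * Real.log (R / 2)) (by simpa [neg_div] using hx.neg) hy ?_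
  filter_upwards [hsmall] with n hn
  have hl := M.len_pos u i n
  have hr : 0 < 2 * M.len u i n := by positivity
  have h1 := H _ R hr hn hρR (min_le_left _ _) hR0 hR1 _ (M.codingPoint_mem_support ω h)
  have h2 : C₂ * (R / (2 * M.len u i n)) ^ d ≤ 1 / mass ω i n :=
    h1.trans (div_le_div₀ zero_le_one measureReal_le_one (mass_pos ω h n)
      (M.le_measureReal_ball ω i (by linarith)))
  have h3 := Real.log_le_log (mul_pos hC₂ (Real.rpow_pos_of_pos (div_pos hR0 hr) _)) h2
  rw [Real.log_div one_ne_zero (mass_pos ω h n).ne', Real.log_mul hC₂.ne'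
    (Real.rpow_pos_of_pos (div_pos hR0 hr) _).ne', Real.log_rpow (div_pos hR0 hr), ← div_div,
    Real.log_div (div_pos hR0 two_pos).ne' (M.len_pos u i n).ne', Real.log_one] at h3
  rw [← log_mass ω h, ← M.log_len u]
  linarith

end IFSFamily

/-! ### Averages, moments and the extremal ratios -/

section Product

variable {Ω : Type*} [MeasurableSpace Ω] (P : Measure Ω) [IsProbabilityMeasure P]

theorem ae_infinitePi_forall {p : Ω → Prop} (hp : ∀ᵐ x ∂P, p x) :
    ∀ᵐ ω ∂(Measure.infinitePi fun _ : ℕ => P), ∀ n, p (ω n) :=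
  ae_all_iff.2 fun n =>
    (measurePreserving_eval_infinitePi (fun _ : ℕ => P) n).quasiMeasurePreserving.ae hp

theorem ae_infinitePi_tendsto_average {f : Ω → ℝ} (hf : Measurable f) (hi : Integrable f P) :
    ∀ᵐ ω ∂(Measure.infinitePi fun _ : ℕ => P),
      Tendsto (fun n : ℕ => (∑ k ∈ Finset.range n, f (ω k)) / n) atTop (𝓝 (∫ x, f x ∂P)) := by
  have hmp (n : ℕ) := measurePreserving_eval_infinitePi (fun _ : ℕ => P) n
  have hind := ProbabilityTheory.iIndepFun_infinitePi (P := fun _ : ℕ => P) (X := fun _ => f)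
    fun _ => hf
  have key := ProbabilityTheory.strong_law_ae_real (μ := Measure.infinitePi fun _ : ℕ => P)
    (fun n ω => f (ω n)) ((hmp 0).integrable_comp_of_integrable hi)
    (fun i j hij => hind.indepFun hij) fun i => ?_
  · have h0 : ∫ ω, f (ω 0) ∂(Measure.infinitePi fun _ : ℕ => P) = ∫ x, f x ∂P := by
      conv_rhs => rw [← (hmp 0).map_eq]
      rw [integral_map (hmp 0).measurable.aemeasurable hf.aestronglyMeasurable]
    rwa [h0] at key
  · refine ⟨(hf.comp (hmp i).measurable).aemeasurable, (hf.comp (hmp 0).measurable).aemeasurable,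
      ?_⟩
    rw [← Function.comp_def f, ← Function.comp_def f, ← Measure.map_map hf (hmp i).measurable,
      ← Measure.map_map hf (hmp 0).measurable, (hmp i).map_eq, (hmp 0).map_eq]

end Product

section Moment

variable {K : ℕ} {ℛ : Measure (Weights K)}

theorem measurable_weight (i : Fin K) : Measurable fun p : Weights K => p.1 i :=
  (measurable_pi_apply i).comp measurable_subtype_coe

theorem FiniteNegMoment.ae_pos (h : FiniteNegMoment ℛ) : ∀ᵐ p ∂ℛ, ∀ i, 0 < p.1 i := by
  obtain ⟨t, ht, H⟩ := h
  refine ae_all_iff.2 fun i => ?_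
  filter_upwards [ae_lt_top (((measurable_weight i).ennreal_ofReal).pow_const _) (H i).ne] with p hp
  refine (p.2.1 i).lt_of_ne fun h0 => ?_
  rw [← h0, ENNReal.ofReal_zero, ENNReal.zero_rpow_of_neg (neg_neg_of_pos ht)] at hp
  exact hp.ne rfl

theorem FiniteNegMoment.integrable_log (h : FiniteNegMoment ℛ) (i : Fin K) :
    Integrable (fun p : Weights K => Real.log (p.1 i)) ℛ := by
  have hpos := h.ae_pos
  obtain ⟨t, ht, H⟩ := h
  have hm : Measurable fun p : Weights K => p.1 i ^ (-t) := (measurable_weight i).pow_const _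
  have hint : Integrable (fun p : Weights K => p.1 i ^ (-t)) ℛ := by
    refine (lintegral_ofReal_ne_top_iff_integrable hm.aestronglyMeasurable
      (ae_of_all _ fun p => Real.rpow_nonneg (p.2.1 i) _)).1 ?_
    refine ne_of_lt (lt_of_eq_of_lt (lintegral_congr_ae ?_) (H i))
    filter_upwards [hpos] with p hp
    rw [ENNReal.ofReal_rpow_of_pos (hp i)]
  refine (hint.div_const t).mono' (measurable_weight i).log.aestronglyMeasurable ?_
  filter_upwards [hpos] with p hp
  have h1 : p.1 i ≤ 1 := by
    have := Finset.single_le_sum (fun j _ => p.2.1 j) (Finset.mem_univ i)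
    rwa [p.2.2] at this
  rw [Real.norm_eq_abs, abs_of_nonpos (Real.log_nonpos (hp i).le h1), ← Real.log_inv]
  have := Real.log_le_rpow_div (inv_nonneg.2 (hp i).le) ht
  rwa [Real.inv_rpow (hp i).le, ← Real.rpow_neg (hp i).le] at this

variable {𝒜 : Type*} [MeasurableSpace 𝒜]

theorem measurable_coord_snd (i : Fin K) : Measurable fun x : 𝒜 × Weights K => x.2.1 i :=
  (measurable_weight i).comp measurable_snd

theorem measurable_log_weight {σ : 𝒜 × Weights K → Fin K} (hσ : Measurable σ) :
    Measurable fun x : 𝒜 × Weights K => Real.log (x.2.1 (σ x)) :=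
  (measurable_from_prod_countable_left (f := fun y : Weights K × Fin K => Real.log (y.1.1 y.2))
    fun i => (measurable_weight i).log).comp (measurable_snd.prodMk hσ)

theorem ae_weight_pos (𝒬 : Measure 𝒜) [SFinite ℛ] (h : FiniteNegMoment ℛ) :
    ∀ᵐ x ∂(𝒬.prod ℛ), ∀ i, 0 < x.2.1 i :=
  Measure.quasiMeasurePreserving_snd.ae h.ae_pos

theorem integral_coord_fst (𝒬 : Measure 𝒜) [SFinite 𝒬] [IsProbabilityMeasure ℛ] (f : 𝒜 → ℝ) :
    ∫ x : 𝒜 × Weights K, f x.1 ∂(𝒬.prod ℛ) = ∫ u, f u ∂𝒬 := by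
  simp [integral_fun_fst]

theorem integrable_log_weight (𝒬 : Measure 𝒜) [IsFiniteMeasure 𝒬] [SFinite ℛ]
    {σ : 𝒜 × Weights K → Fin K} (h : FiniteNegMoment ℛ) (hσ : Measurable σ) :
    Integrable (fun x : 𝒜 × Weights K => Real.log (x.2.1 (σ x))) (𝒬.prod ℛ) := by
  refine (integrable_finsetSum Finset.univ fun i _ =>
    ((h.integrable_log i).comp_snd 𝒬).abs).mono' (measurable_log_weight hσ).aestronglyMeasurable
    (ae_of_all _ fun x => ?_)
  exact Finset.single_le_sum (f := fun i => |Real.log (x.2.1 i)|) (fun i _ => abs_nonneg _)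
    (Finset.mem_univ (σ x))

end Moment

/-- If `s x ≤ y` for two probability vectors, then their coordinates differ by at most
`1 - s ≤ -log s`. -/
theorem abs_sub_le_neg_log {ι : Type*} [Fintype ι] {x y : ι → ℝ} {s : ℝ} (hs : 0 < s)
    (hx : ∀ i, 0 ≤ x i) (hx1 : ∑ i, x i = 1) (hy1 : ∑ i, y i = 1)
    (h : ∀ i, s * x i ≤ y i) (i : ι) : |x i - y i| ≤ -Real.log s := by
  classical
  have hlog := Real.log_le_sub_one_of_pos hs
  have hs1 : s ≤ 1 := by
    have := Finset.sum_le_sum fun i (_ : i ∈ Finset.univ) => h i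
    rwa [← Finset.mul_sum, hx1, hy1, mul_one] at this
  have hX := Finset.add_sum_erase Finset.univ x (Finset.mem_univ i)
  have hY := Finset.add_sum_erase Finset.univ y (Finset.mem_univ i)
  have hle := Finset.sum_le_sum fun j (_ : j ∈ Finset.univ.erase i) => h j
  rw [← Finset.mul_sum] at hle
  have h0 : 0 ≤ ∑ j ∈ Finset.univ.erase i, x j := Finset.sum_nonneg fun j _ => hx j
  have h1 := h i
  have h2 := hx i
  rw [hx1] at hX
  rw [hy1] at hY
  rw [abs_le]
  constructor <;> nlinarith

namespace IFSFamily

variable {𝒜 : Type*} {K : ℕ} (M : IFSFamily 𝒜 K)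

theorem nonempty_fin (M : IFSFamily 𝒜 K) : Nonempty (Fin K) := ⟨⟨0, by have := M.two_le; omega⟩⟩

theorem sum_rpow_pos (θ : ℝ) (u : 𝒜) : 0 < ∑ l, M.a u l ^ θ :=
  haveI := M.nonempty_fin
  Finset.sum_pos (fun _ _ => Real.rpow_pos_of_pos (M.a_pos _ _) _) Finset.univ_nonempty

/-- The normalized weights `a_i ^ θ / ∑ l, a_l ^ θ` of the iterated function system `u`. -/
noncomputable def normWeight (θ : ℝ) (u : 𝒜) (i : Fin K) : ℝ := M.a u i ^ θ / ∑ l, M.a u l ^ θ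

theorem normWeight_pos (θ : ℝ) (u : 𝒜) (i : Fin K) : 0 < M.normWeight θ u i :=
  div_pos (Real.rpow_pos_of_pos (M.a_pos _ _) _) (M.sum_rpow_pos θ u)

theorem sum_normWeight (θ : ℝ) (u : 𝒜) : ∑ i, M.normWeight θ u i = 1 := by
  simp only [normWeight]
  rw [← Finset.sum_div, div_self (M.sum_rpow_pos θ u).ne']

theorem log_normWeight (θ : ℝ) (u : 𝒜) (i : Fin K) :
    Real.log (M.normWeight θ u i) = θ * Real.log (M.a u i) - Real.log (∑ l, M.a u l ^ θ) := by
  rw [normWeight, Real.log_div (Real.rpow_pos_of_pos (M.a_pos _ _) _).ne' (M.sum_rpow_pos θ u).ne',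
    Real.log_rpow (M.a_pos _ _)]

theorem m_spec (θ : ℝ) (x : 𝒜 × Weights K) (j : Fin K) :
    M.a x.1 j ^ θ / x.2.1 j ≤ M.a x.1 (M.m θ x) ^ θ / x.2.1 (M.m θ x) := by
  have : M.m θ x ∈ M.maxIndices θ x := Finset.min'_mem _ _
  simp only [maxIndices, Finset.mem_filter, Finset.mem_univ, true_and] at this
  exact this j

theorem m'_spec (θ : ℝ) (x : 𝒜 × Weights K) (j : Fin K) :
    M.a x.1 (M.m' θ x) ^ θ / x.2.1 (M.m' θ x) ≤ M.a x.1 j ^ θ / x.2.1 j := by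
  have : M.m' θ x ∈ M.minIndices θ x := Finset.min'_mem _ _
  simp only [minIndices, Finset.mem_filter, Finset.mem_univ, true_and] at this
  exact this j

/-- At the index `m`, the normalized weight exceeds `p` by a factor which controls the distance of
the two probability vectors. -/
theorem abs_normWeight_sub_le_m (θ : ℝ) {x : 𝒜 × Weights K} (hx : ∀ i, 0 < x.2.1 i) (i : Fin K) :
    |M.normWeight θ x.1 i - x.2.1 i| ≤ θ * Real.log (M.a x.1 (M.m θ x)) -
      Real.log (∑ l, M.a x.1 l ^ θ) - Real.log (x.2.1 (M.m θ x)) := by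
  have hw := M.normWeight_pos θ x.1 (M.m θ x)
  refine (abs_sub_le_neg_log (s := x.2.1 (M.m θ x) / M.normWeight θ x.1 (M.m θ x))
    (div_pos (hx _) hw) (fun j => (M.normWeight_pos θ x.1 j).le) (M.sum_normWeight θ x.1) x.2.2.2
    (fun j => ?_) i).trans_eq ?_
  · have h := M.m_spec θ x j
    rw [div_le_div_iff₀ (hx _) (hx _)] at h
    rw [div_mul_eq_mul_div, div_le_iff₀ hw]
    simp only [normWeight]
    rw [mul_div_assoc', mul_div_assoc', div_le_div_iff_of_pos_right (M.sum_rpow_pos θ x.1)]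
    linarith
  · rw [Real.log_div (hx _).ne' hw.ne', log_normWeight]
    ring

theorem abs_normWeight_sub_le_m' (θ : ℝ) {x : 𝒜 × Weights K} (hx : ∀ i, 0 < x.2.1 i) (i : Fin K) :
    |M.normWeight θ x.1 i - x.2.1 i| ≤ Real.log (x.2.1 (M.m' θ x)) -
      (θ * Real.log (M.a x.1 (M.m' θ x)) - Real.log (∑ l, M.a x.1 l ^ θ)) := by
  have hw := M.normWeight_pos θ x.1 (M.m' θ x)
  rw [abs_sub_comm]
  refine (abs_sub_le_neg_log (s := M.normWeight θ x.1 (M.m' θ x) / x.2.1 (M.m' θ x))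
    (div_pos hw (hx _)) (fun j => (hx j).le) x.2.2.2 (M.sum_normWeight θ x.1)
    (fun j => ?_) i).trans_eq ?_
  · have h := M.m'_spec θ x j
    rw [div_le_div_iff₀ (hx _) (hx _)] at h
    rw [div_mul_eq_mul_div, div_le_iff₀ (hx _)]
    simp only [normWeight]
    rw [div_mul_eq_mul_div, div_mul_eq_mul_div, div_le_div_iff_of_pos_right (M.sum_rpow_pos θ x.1)]
    linarith
  · rw [Real.log_div hw.ne' (hx _).ne', log_normWeight]
    ring

variable [Finite 𝒜] [MeasurableSpace 𝒜] [MeasurableSingletonClass 𝒜]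

theorem measurable_coord_fst (f : 𝒜 → ℝ) : Measurable fun x : 𝒜 × Weights K => f x.1 :=
  (measurable_of_countable f).comp measurable_fst

theorem measurable_ratio (θ : ℝ) (j : Fin K) :
    Measurable fun x : 𝒜 × Weights K => M.a x.1 j ^ θ / x.2.1 j :=
  (measurable_coord_fst fun u => M.a u j ^ θ).div (measurable_coord_snd j)

/-- The least element of a random nonempty finite set of indices is measurable. -/
theorem measurable_min' {Ω : Type*} [MeasurableSpace Ω] {s : Ω → Finset (Fin K)}
    (hs : ∀ j, MeasurableSet {x | j ∈ s x}) (hne : ∀ x, (s x).Nonempty) :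
    Measurable fun x => (s x).min' (hne x) := by
  refine measurable_to_countable' fun j => ?_
  have : (fun x => (s x).min' (hne x)) ⁻¹' {j} =
      {x | j ∈ s x} ∩ ⋂ i : Fin K, ⋂ _ : i < j, {x | i ∈ s x}ᶜ := by
    ext x
    simp only [Set.mem_preimage, Set.mem_singleton_iff, Set.mem_inter_iff, Set.mem_iInter,
      Set.mem_compl_iff, Set.mem_ofPred_eq]
    constructor
    · rintro rfl
      exact ⟨Finset.min'_mem _ _, fun i hi hmem => (Finset.min'_le _ _ hmem).not_gt hi⟩
    · rintro ⟨h1, h2⟩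
      exact le_antisymm (Finset.min'_le _ _ h1)
        (not_lt.1 fun h => h2 _ h (Finset.min'_mem _ _))
  rw [this]
  exact (hs j).inter (MeasurableSet.iInter fun i => MeasurableSet.iInter fun _ => (hs i).compl)

theorem measurable_m (θ : ℝ) : Measurable (M.m θ) := by
  refine measurable_min' (fun j => ?_) (M.maxIndices_nonempty θ)
  simp only [maxIndices, Finset.mem_filter, Finset.mem_univ, true_and]
  rw [Set.ofPred_forall]
  exact MeasurableSet.iInter fun i =>
    measurableSet_le (M.measurable_ratio θ i) (M.measurable_ratio θ j)

theorem measurable_m' (θ : ℝ) : Measurable (M.m' θ) := by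
  refine measurable_min' (fun j => ?_) (M.minIndices_nonempty θ)
  simp only [minIndices, Finset.mem_filter, Finset.mem_univ, true_and]
  rw [Set.ofPred_forall]
  exact MeasurableSet.iInter fun i =>
    measurableSet_le (M.measurable_ratio θ j) (M.measurable_ratio θ i)

variable {σ : 𝒜 × Weights K → Fin K}

theorem measurable_log_a (hσ : Measurable σ) :
    Measurable fun x : 𝒜 × Weights K => Real.log (M.a x.1 (σ x)) :=
  (measurable_of_countable fun y : 𝒜 × Fin K => Real.log (M.a y.1 y.2)).comp
    (measurable_fst.prodMk hσ)

variable (𝒬 : Measure 𝒜) [IsProbabilityMeasure 𝒬] {ℛ : Measure (Weights K)}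
  [IsProbabilityMeasure ℛ]

theorem integrable_log_a (hσ : Measurable σ) :
    Integrable (fun x : 𝒜 × Weights K => Real.log (M.a x.1 (σ x))) (𝒬.prod ℛ) :=
  Integrable.of_mem_Icc (Real.log M.A) (Real.log M.B) (M.measurable_log_a hσ).aemeasurable
    (ae_of_all _ fun _ => ⟨M.log_A_le _ _, M.log_a_le _ _⟩)

theorem integral_log_a_neg (hσ : Measurable σ) :
    ∫ x : 𝒜 × Weights K, Real.log (M.a x.1 (σ x)) ∂(𝒬.prod ℛ) < 0 := by
  have : ∫ x : 𝒜 × Weights K, Real.log (M.a x.1 (σ x)) ∂(𝒬.prod ℛ) ≤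
      ∫ _ : 𝒜 × Weights K, Real.log M.B ∂(𝒬.prod ℛ) :=
    integral_mono (M.integrable_log_a 𝒬 hσ) (integrable_const _) fun x => M.log_a_le _ _
  rw [integral_const, probReal_univ, one_smul] at this
  exact this.trans_lt (Real.log_neg M.B_pos M.B_lt_one)

theorem log_A_le_integral (hσ : Measurable σ) :
    Real.log M.A ≤ ∫ x : 𝒜 × Weights K, Real.log (M.a x.1 (σ x)) ∂(𝒬.prod ℛ) := by
  have : ∫ _ : 𝒜 × Weights K, Real.log M.A ∂(𝒬.prod ℛ) ≤
      ∫ x : 𝒜 × Weights K, Real.log (M.a x.1 (σ x)) ∂(𝒬.prod ℛ) :=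
    integral_mono (integrable_const _) (M.integrable_log_a 𝒬 hσ) fun x => M.log_A_le _ _
  rwa [integral_const, probReal_univ, one_smul] at this

variable {D : ℝ}

theorem integral_abs_le_of_m (hD : M.IsMoranRoot 𝒬 D) (h : FiniteNegMoment ℛ) (i : Fin K) :
    ∫ x : 𝒜 × Weights K, |M.normWeight D x.1 i - x.2.1 i| ∂(𝒬.prod ℛ) ≤
      D * ∫ x, Real.log (M.a x.1 (M.m D x)) ∂(𝒬.prod ℛ) -
        ∫ x, Real.log (x.2.1 (M.m D x)) ∂(𝒬.prod ℛ) := by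
  have h1 := (M.integrable_log_a 𝒬 (ℛ := ℛ) (M.measurable_m D)).const_mul D
  have h2 : Integrable (fun x : 𝒜 × Weights K => Real.log (∑ l, M.a x.1 l ^ D)) (𝒬.prod ℛ) :=
    (Integrable.of_finite (μ := 𝒬) (f := fun u => Real.log (∑ l, M.a u l ^ D))).comp_fst ℛ
  have h3 := integrable_log_weight 𝒬 h (M.measurable_m D)
  refine (integral_mono_of_nonneg (ae_of_all _ fun x => abs_nonneg _)
    ((h1.sub h2).sub h3) ?_).trans_eq ?_
  · filter_upwards [ae_weight_pos 𝒬 h] with x hx using M.abs_normWeight_sub_le_m D hx i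
  · rw [integral_sub' (h1.sub h2) h3, integral_sub' h1 h2, integral_const_mul,
      integral_coord_fst 𝒬 fun u => Real.log (∑ l, M.a u l ^ D), hD.2, sub_zero]

theorem integral_abs_le_of_m' (hD : M.IsMoranRoot 𝒬 D) (h : FiniteNegMoment ℛ) (i : Fin K) :
    ∫ x : 𝒜 × Weights K, |M.normWeight D x.1 i - x.2.1 i| ∂(𝒬.prod ℛ) ≤
      ∫ x, Real.log (x.2.1 (M.m' D x)) ∂(𝒬.prod ℛ) -
        D * ∫ x, Real.log (M.a x.1 (M.m' D x)) ∂(𝒬.prod ℛ) := by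
  have h1 := (M.integrable_log_a 𝒬 (ℛ := ℛ) (M.measurable_m' D)).const_mul D
  have h2 : Integrable (fun x : 𝒜 × Weights K => Real.log (∑ l, M.a x.1 l ^ D)) (𝒬.prod ℛ) :=
    (Integrable.of_finite (μ := 𝒬) (f := fun u => Real.log (∑ l, M.a u l ^ D))).comp_fst ℛ
  have h3 := integrable_log_weight 𝒬 h (M.measurable_m' D)
  refine (integral_mono_of_nonneg (ae_of_all _ fun x => abs_nonneg _)
    (h3.sub (h1.sub h2)) ?_).trans_eq ?_
  · filter_upwards [ae_weight_pos 𝒬 h] with x hx using M.abs_normWeight_sub_le_m' D hx i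
  · rw [integral_sub' h3 (h1.sub h2), integral_sub' h1 h2, integral_const_mul,
      integral_coord_fst 𝒬 fun u => Real.log (∑ l, M.a u l ^ D), hD.2, sub_zero]

/-- If the normalized weights of two systems of positive probability differ, then on average they
are bounded away from any independent weights. -/
theorem le_integral_abs_normWeight_sub (θ : ℝ) (i : Fin K) {j j' : 𝒜}
    (hne : M.normWeight θ j i ≠ M.normWeight θ j' i) :
    min (𝒬.real {j}) (𝒬.real {j'}) * |M.normWeight θ j i - M.normWeight θ j' i| ≤
      ∫ x : 𝒜 × Weights K, |M.normWeight θ x.1 i - x.2.1 i| ∂(𝒬.prod ℛ) := by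
  classical
  cases nonempty_fintype 𝒜
  have hb (u : 𝒜) (p : Weights K) : |M.normWeight θ u i - p.1 i| ≤ M.normWeight θ u i + 1 := by
    have h1 : p.1 i ≤ 1 := by
      have := Finset.single_le_sum (fun j _ => p.2.1 j) (Finset.mem_univ i)
      rwa [p.2.2] at this
    have h2 := p.2.1 i
    have h3 := M.normWeight_pos θ u i
    rw [abs_le]
    constructor <;> linarith
  have hI (u : 𝒜) : Integrable (fun p : Weights K => |M.normWeight θ u i - p.1 i|) ℛ :=
    (integrable_const (M.normWeight θ u i + 1)).mono'
      ((measurable_const.sub (measurable_weight i)).abs).aestronglyMeasurable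
      (ae_of_all _ fun p => by rw [Real.norm_eq_abs, abs_abs]; exact hb u p)
  have hI2 : Integrable (fun x : 𝒜 × Weights K => |M.normWeight θ x.1 i - x.2.1 i|) (𝒬.prod ℛ) :=
    ((Integrable.of_finite (μ := 𝒬) (f := fun u => M.normWeight θ u i + 1)).comp_fst ℛ).mono'
      (((measurable_coord_fst fun u => M.normWeight θ u i).sub
        (measurable_coord_snd i)).abs).aestronglyMeasurable
      (ae_of_all _ fun x => by rw [Real.norm_eq_abs, abs_abs]; exact hb x.1 x.2)
  rw [integral_prod _ hI2, integral_fintype Integrable.of_finite]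
  set φ : 𝒜 → ℝ := fun u => ∫ p : Weights K, |M.normWeight θ u i - p.1 i| ∂ℛ
  have hφ (u : 𝒜) : 0 ≤ φ u := integral_nonneg fun p => abs_nonneg _
  have hjj : j ≠ j' := fun h => hne (by rw [h])
  have hsum : |M.normWeight θ j i - M.normWeight θ j' i| ≤ φ j + φ j' := by
    rw [← integral_add (hI j) (hI j')]
    have h1 : ∫ _ : Weights K, |M.normWeight θ j i - M.normWeight θ j' i| ∂ℛ ≤
        ∫ p : Weights K, (|M.normWeight θ j i - p.1 i| + |M.normWeight θ j' i - p.1 i|) ∂ℛ := by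
      refine integral_mono (integrable_const _) ((hI j).add (hI j')) fun p => ?_
      simpa [abs_sub_comm (p.1 i)] using
        abs_sub_le (M.normWeight θ j i) (p.1 i) (M.normWeight θ j' i)
    rwa [integral_const, probReal_univ, one_smul] at h1
  calc _ ≤ min (𝒬.real {j}) (𝒬.real {j'}) * (φ j + φ j') := by gcongr
    _ = min (𝒬.real {j}) (𝒬.real {j'}) * φ j + min (𝒬.real {j}) (𝒬.real {j'}) * φ j' := by ring
    _ ≤ 𝒬.real {j} * φ j + 𝒬.real {j'} * φ j' :=
      add_le_add (mul_le_mul_of_nonneg_right (min_le_left _ _) (hφ _))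
        (mul_le_mul_of_nonneg_right (min_le_right _ _) (hφ _))
    _ = ∑ u ∈ ({j, j'} : Finset 𝒜), 𝒬.real {u} • φ u := by
      rw [Finset.sum_pair hjj]; rfl
    _ ≤ _ := Finset.sum_le_sum_of_subset_of_nonneg (Finset.subset_univ _)
      fun u _ _ => smul_nonneg measureReal_nonneg (hφ u)

end IFSFamily

/-! ### The dimension equation and the Hausdorff dimension -/

namespace IFSFamily

variable {𝒜 : Type*} {K : ℕ} (M : IFSFamily 𝒜 K)

/-- The logarithm of the Moran sum `∑ l, a_l ^ θ` of the iterated function system `v`. -/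
noncomputable def logSum (θ : ℝ) (v : 𝒜) : ℝ := Real.log (∑ l, M.a v l ^ θ)

theorem logSum_zero_pos (v : 𝒜) : 0 < M.logSum 0 v := by
  have : (1 : ℝ) < K := by exact_mod_cast M.two_le
  simpa [logSum] using Real.log_pos this

theorem logSum_one_neg (v : 𝒜) : M.logSum 1 v < 0 := by
  have h := M.sum_rpow_pos 1 v
  refine Real.log_neg h ?_
  simpa using (M.sum_le v).trans_lt M.B_lt_one

theorem logSum_le {x y : ℝ} (h : x ≤ y) (v : 𝒜) :
    M.logSum y v ≤ M.logSum x v + (y - x) * Real.log M.B := by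
  rw [logSum, logSum, ← Real.log_rpow M.B_pos, ← Real.log_mul (M.sum_rpow_pos x v).ne'
    (Real.rpow_pos_of_pos M.B_pos _).ne', Finset.sum_mul]
  refine Real.log_le_log (M.sum_rpow_pos y v) (Finset.sum_le_sum fun l _ => ?_)
  calc M.a v l ^ y = M.a v l ^ x * M.a v l ^ (y - x) := by
        rw [← Real.rpow_add (M.a_pos v l)]; ring_nf
    _ ≤ _ := mul_le_mul_of_nonneg_left
        (Real.rpow_le_rpow (M.a_pos v l).le (M.a_le_B v l) (sub_nonneg.2 h))
        (Real.rpow_nonneg (M.a_pos v l).le _)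

theorem continuous_logSum (v : 𝒜) : Continuous fun x => M.logSum x v := by
  refine Continuous.log (continuous_finsetSum _ fun l _ => ?_) fun x => (M.sum_rpow_pos x v).ne'
  exact Real.continuous_const_rpow (M.a_pos v l).ne'

section Root

variable [Finite 𝒜] [MeasurableSpace 𝒜] [MeasurableSingletonClass 𝒜]
  (𝒬 : Measure 𝒜) [IsProbabilityMeasure 𝒬]

theorem integral_logSum_le {x y : ℝ} (h : x ≤ y) :
    ∫ v, M.logSum y v ∂𝒬 ≤ ∫ v, M.logSum x v ∂𝒬 + (y - x) * Real.log M.B := by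
  have := integral_mono (μ := 𝒬) (Integrable.of_finite)
    (Integrable.of_finite.add (integrable_const _)) fun v => M.logSum_le h v
  rwa [integral_add Integrable.of_finite (integrable_const _), integral_const, probReal_univ,
    one_smul] at this

theorem exists_isMoranRoot : ∃ D, 0 < D ∧ M.IsMoranRoot 𝒬 D := by
  cases nonempty_fintype 𝒜
  have hc : Continuous fun x => ∫ v, M.logSum x v ∂𝒬 := by
    simp only [integral_fintype Integrable.of_finite]
    refine continuous_finsetSum _ fun v _ => ?_
    have := M.continuous_logSum v
    simp only [smul_eq_mul]
    fun_prop
  obtain ⟨v, hv⟩ : ∃ v, 𝒬.real {v} ≠ 0 := by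
    by_contra! h
    have h1 : ∫ _ : 𝒜, (1 : ℝ) ∂𝒬 = 0 := by
      rw [integral_fintype Integrable.of_finite]; simp [h]
    simp at h1
  have hv' : 0 < 𝒬.real {v} := measureReal_nonneg.lt_of_ne' hv
  have h0 : 0 < ∫ v, M.logSum 0 v ∂𝒬 := by
    rw [integral_fintype Integrable.of_finite]
    exact Finset.sum_pos' (fun w _ => smul_nonneg measureReal_nonneg (M.logSum_zero_pos w).le)
      ⟨v, Finset.mem_univ _, smul_pos hv' (M.logSum_zero_pos v)⟩
  have h1 : ∫ v, M.logSum 1 v ∂𝒬 ≤ 0 := integral_nonpos fun v => (M.logSum_one_neg v).le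
  obtain ⟨D, hD, hD0⟩ := intermediate_value_Icc' zero_le_one hc.continuousOn ⟨h1, h0.le⟩
  refine ⟨D, hD.1.lt_of_ne fun h => ?_, hD.1, hD0⟩
  rw [← h] at hD0
  exact h0.ne' hD0

theorem IsMoranRoot.eq {x y : ℝ} (hx : M.IsMoranRoot 𝒬 x) (hy : M.IsMoranRoot 𝒬 y) : x = y := by
  have key : ∀ {x y : ℝ}, M.IsMoranRoot 𝒬 x → M.IsMoranRoot 𝒬 y → ¬ x < y := by
    intro x y hx hy h
    have h1 := M.integral_logSum_le 𝒬 h.le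
    have hx2 : ∫ v, M.logSum x v ∂𝒬 = 0 := hx.2
    have hy2 : ∫ v, M.logSum y v ∂𝒬 = 0 := hy.2
    rw [hx2, hy2, zero_add] at h1
    exact (mul_neg_of_pos_of_neg (sub_pos.2 h) (Real.log_neg M.B_pos M.B_lt_one)).not_ge h1
  exact le_antisymm (not_lt.1 (key hy hx)) (not_lt.1 (key hx hy))

end Root

section Hausdorff

open scoped NNReal ENNReal

theorem sum_len_rpow (u : ℕ → 𝒜) (s : ℝ) (n : ℕ) (e : (Fin n → Fin K) → ℕ → Fin K)
    (he : ∀ w (k : Fin n), e w k = w k) :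
    ∑ w, M.len u (e w) n ^ s = Real.exp (∑ k ∈ Finset.range n, M.logSum s (u k)) := by
  rw [Real.exp_sum]
  calc ∑ w, M.len u (e w) n ^ s = ∑ w : Fin n → Fin K, ∏ k : Fin n, M.a (u k) (w k) ^ s := by
        refine Finset.sum_congr rfl fun w _ => ?_
        rw [len, ← Real.finsetProd_rpow _ _ fun _ _ => (M.a_pos _ _).le, Finset.prod_range]
        exact Finset.prod_congr rfl fun k _ => by rw [he]
    _ = ∏ k : Fin n, ∑ l, M.a (u k) l ^ s := by
        rw [Finset.prod_univ_sum, Fintype.piFinset_univ]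
    _ = ∏ k ∈ Finset.range n, ∑ l, M.a (u k) l ^ s :=
        (Finset.prod_range fun k => ∑ l, M.a (u k) l ^ s).symm
    _ = _ := Finset.prod_congr rfl fun k _ => (Real.exp_log (M.sum_rpow_pos s (u k))).symm

theorem ediam_moranInterval_le (u : ℕ → 𝒜) (i : ℕ → Fin K) (n : ℕ) :
    Metric.ediam (M.moranInterval u i n) ≤ ENNReal.ofReal (M.len u i n) := by
  refine Metric.ediam_le ?_
  rintro _ ⟨x, rfl⟩ _ ⟨y, rfl⟩
  rw [edist_dist, dist_comp]
  exact ENNReal.ofReal_le_ofReal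
    (mul_le_of_le_one_right (M.len_pos u i n).le (unitInterval_dist_le_one x y))

/-- The covers of the Moran set by the Moran intervals of step `n` bound its dimension. -/
theorem dimH_moranSet_le (u : ℕ → 𝒜) (s : ℝ≥0) {c : ℝ} (hc : c < 0)
    (h : Tendsto (fun n : ℕ => (∑ k ∈ Finset.range n, M.logSum s (u k)) / n) atTop (𝓝 c)) :
    dimH (M.moranSet u) ≤ s := by
  classical
  obtain ⟨i₀⟩ := M.nonempty_fin
  let e (n : ℕ) (w : Fin n → Fin K) (k : ℕ) : Fin K := if hk : k < n then w ⟨k, hk⟩ else i₀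
  have he (n : ℕ) (w : Fin n → Fin K) (k : Fin n) : e n w k = w k := by simp [e]
  have hS : Tendsto (fun n : ℕ => ∑ k ∈ Finset.range n, M.logSum s (u k)) atTop atBot := by
    refine (h.neg_mul_atTop hc tendsto_natCast_atTop_atTop).congr' ?_
    filter_upwards [eventually_ne_atTop 0] with n hn
    field_simp
  have hexp := ENNReal.tendsto_ofReal (Real.tendsto_exp_atBot.comp hS)
  rw [ENNReal.ofReal_zero] at hexp
  refine dimH_le_of_hausdorffMeasure_ne_top (ne_top_of_le_ne_top ENNReal.zero_ne_top ?_)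
  have hB : Tendsto (fun n : ℕ => ENNReal.ofReal (M.B ^ n)) atTop (𝓝 0) := by
    simpa using ENNReal.tendsto_ofReal
      (tendsto_pow_atTop_nhds_zero_of_lt_one M.B_pos.le M.B_lt_one)
  refine (Measure.hausdorffMeasure_le_liminf_sum (l := atTop) (ι := fun n => Fin n → Fin K) s _
    (fun n => ENNReal.ofReal (M.B ^ n)) hB (fun n w => M.moranInterval u (e n w) n)
    (Eventually.of_forall fun n w => (M.ediam_moranInterval_le u _ n).trans
      (ENNReal.ofReal_le_ofReal (M.len_le u _ n)))
    (Eventually.of_forall fun n x hx => ?_)).trans ?_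
  · obtain ⟨i, hi⟩ := Set.mem_iUnion.1 (Set.mem_iInter.1 hx n)
    refine Set.mem_iUnion.2 ⟨fun k => i k, ?_⟩
    rwa [moranInterval, M.comp_congr u (j := i) fun k hk => by simp [e, hk]]
  · rw [← hexp.liminf_eq]
    refine liminf_le_liminf (Eventually.of_forall fun n => ?_)
    rw [Function.comp_apply, ← M.sum_len_rpow u s n (e n) (he n),
      ENNReal.ofReal_sum_of_nonneg fun w _ => Real.rpow_nonneg (M.len_pos u _ n).le _]
    refine Finset.sum_le_sum fun w _ => ?_
    rw [← ENNReal.ofReal_rpow_of_nonneg (M.len_pos u (e n w) n).le s.coe_nonneg]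
    exact ENNReal.rpow_le_rpow (M.ediam_moranInterval_le u _ n) s.coe_nonneg

variable (ω : ℕ → 𝒜 × Weights K)

theorem measureReal_ball_le_rpow {s C : ℝ} (hs : 0 ≤ s) (hC : 0 ≤ C)
    (h : ∀ i n, mass ω i n ≤ C * M.len (fun k => (ω k).1) i n ^ s) (i : ℕ → Fin K) {R : ℝ}
    (hR : 0 < R) (hRτ : R ≤ M.τ) :
    (M.moranMeasure ω).real (Metric.ball (M.codingPoint (fun k => (ω k).1) i) R) ≤
      C * (1 / (M.τ * M.A)) ^ s * R ^ s := by
  obtain ⟨n, h1, h2⟩ := M.exists_len_scale (fun k => (ω k).1) i hR hRτ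
  refine (M.measureReal_ball_le ω i h1).trans ((h i n).trans ?_)
  have hA := M.A_pos
  have hτ := M.τ_pos
  rw [mul_assoc, ← Real.mul_rpow (by positivity) hR.le]
  refine mul_le_mul_of_nonneg_left (Real.rpow_le_rpow (M.len_pos _ i n).le ?_ hs) hC
  rw [one_div_mul_eq_div, le_div_iff₀ (by positivity)]
  have h3 := mul_le_mul_of_nonneg_left (M.le_len_add (fun k => (ω k).1) i n 1) hτ.le
  rw [pow_one] at h3
  linarith

/-- The mass distribution principle: a power bound for the masses of the Moran intervals bounds
the dimension of the Moran set from below. -/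
theorem le_dimH_moranSet {s : ℝ≥0} (hs : 0 < s) {C : ℝ} (hC : 0 < C)
    (h : ∀ i n, mass ω i n ≤ C * M.len (fun k => (ω k).1) i n ^ (s : ℝ)) :
    (s : ℝ≥0∞) ≤ dimH (M.moranSet fun k => (ω k).1) := by
  set u : ℕ → 𝒜 := fun k => (ω k).1
  set μ := M.moranMeasure ω
  have hs' : (0 : ℝ) < s := hs
  have hτ := M.τ_pos
  have hA := M.A_pos
  set C' := C * (1 / (M.τ * M.A)) ^ (s : ℝ)
  have hC' : 0 < C' := by positivity
  have hrange : μ (Set.range (M.codingPoint u))ᶜ = 0 := by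
    have := (M.isCompact_range_codingPoint u).isClosed.measurableSet.compl
    change M.moranMeasure ω _ = 0
    rw [moranMeasure, Measure.map_apply (M.measurable_codingPoint _) this]
    simp [u]
  have hle : ENNReal.ofReal C'⁻¹ • μ ≤ μH[(s : ℝ)] := by
    refine Measure.le_hausdorffMeasure _ _ (ENNReal.ofReal (M.τ / 2)) (by simpa using hτ)
      fun U hU => ?_
    rw [Measure.smul_apply, smul_eq_mul]
    by_cases hx : ∃ i, M.codingPoint u i ∈ U
    · obtain ⟨i, hi⟩ := hx
      have hfin : Metric.ediam U ≠ ⊤ := ne_top_of_le_ne_top ENNReal.ofReal_ne_top hU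
      have hdU : Metric.diam U < M.τ :=
        (ENNReal.toReal_le_of_le_ofReal (by positivity) hU).trans_lt (by linarith)
      have hball : ∀ R ∈ Set.Ioo (Metric.diam U) M.τ, μ.real U ≤ C' * R ^ (s : ℝ) := by
        intro R hR
        have hR0 : 0 < R := Metric.diam_nonneg.trans_lt hR.1
        refine (measureReal_mono fun y hy => ?_).trans
          (M.measureReal_ball_le_rpow ω hs'.le hC.le h i hR0 hR.2.le)
        exact (Metric.dist_le_diam_of_mem' hfin hy hi).trans_lt hR.1
      have hlim : μ.real U ≤ C' * Metric.diam U ^ (s : ℝ) := by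
        have hcont : Tendsto (fun R : ℝ => C' * R ^ (s : ℝ)) (𝓝[>] Metric.diam U)
            (𝓝 (C' * Metric.diam U ^ (s : ℝ))) :=
          ((Real.continuous_rpow_const hs'.le).const_mul C').continuousAt.tendsto.mono_left
            nhdsWithin_le_nhds
        refine ge_of_tendsto hcont ?_
        filter_upwards [Ioo_mem_nhdsGT hdU] with R hR using hball R hR
      rw [← ENNReal.ofReal_toReal hfin, ENNReal.ofReal_rpow_of_nonneg ENNReal.toReal_nonneg hs'.le,
        ← ofReal_measureReal, ← ENNReal.ofReal_mul (by positivity)]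
      refine ENNReal.ofReal_le_ofReal ?_
      rw [inv_mul_le_iff₀ hC']
      exact hlim
    · have : μ U = 0 := by
        refine measure_mono_null (fun y hy => ?_) hrange
        rintro ⟨i, rfl⟩
        exact hx ⟨i, hy⟩
      simp [this]
  refine le_dimH_of_hausdorffMeasure_ne_zero fun h0 => ?_
  have h1 := hle (M.moranSet u)
  rw [h0, Measure.smul_apply, smul_eq_mul, nonpos_iff_eq_zero, mul_eq_zero] at h1
  rcases h1 with h1 | h1
  · rw [ENNReal.ofReal_eq_zero] at h1
    exact (inv_pos.2 hC').not_ge h1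
  · have hsub : Set.range (M.codingPoint u) ⊆ M.moranSet u := by
      rintro _ ⟨i, rfl⟩
      exact M.codingPoint_mem_moranSet u i
    have h2 : μ Set.univ = 0 := by
      rw [← Set.union_compl_self (Set.range (M.codingPoint u))]
      exact measure_union_null (measure_mono_null hsub h1) hrange
    rw [measure_univ] at h2
    exact one_ne_zero h2

/-- The masses of the Moran intervals for normalized weights. -/
theorem mass_eq_of_normWeight {θ : ℝ} (h : ∀ k i, (ω k).2.1 i = M.normWeight θ (ω k).1 i)
    (i : ℕ → Fin K) (n : ℕ) :
    mass ω i n = M.len (fun k => (ω k).1) i n ^ θ *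
      Real.exp (-∑ k ∈ Finset.range n, M.logSum θ (ω k).1) := by
  have hlen := M.len_pos (fun k => (ω k).1) i n
  have hpos : ∀ k, 0 < (ω k).2.1 (i k) := fun k => by rw [h]; exact M.normWeight_pos _ _ _
  rw [← Real.exp_log (mass_pos ω hpos n), log_mass ω hpos, Real.rpow_def_of_pos hlen, log_len,
    ← Real.exp_add, Finset.sum_mul, ← sub_eq_add_neg, ← Finset.sum_sub_distrib]
  congr 1
  refine Finset.sum_congr rfl fun k _ => ?_
  rw [h, log_normWeight, logSum, mul_comm]

/-- The weight vector with entries `normWeight θ v`. -/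
noncomputable def normWeights (θ : ℝ) (v : 𝒜) : Weights K :=
  ⟨M.normWeight θ v, fun i => (M.normWeight_pos θ v i).le, M.sum_normWeight θ v⟩

theorem dimH_moranSet_eq (u : ℕ → 𝒜) {D : ℝ} (hD : 0 < D)
    (hle : ∀ m : ℕ, dimH (M.moranSet u) ≤ ENNReal.ofReal (D + 1 / ((m : ℝ) + 1)))
    (h : Tendsto (fun n : ℕ => (∑ k ∈ Finset.range n, M.logSum D (u k)) / n) atTop (𝓝 0)) :
    dimH (M.moranSet u) = ENNReal.ofReal D := by
  refine le_antisymm ?_ ?_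
  · have ht := ENNReal.tendsto_ofReal ((tendsto_const_nhds (x := D)).add
      (tendsto_one_div_add_atTop_nhds_zero_nat (𝕜 := ℝ)))
    rw [add_zero] at ht
    exact ge_of_tendsto' ht hle
  · refine le_of_forall_lt_imp_le_of_dense fun q hq => ?_
    lift q to ℝ≥0 using (hq.trans_le le_top).ne
    rcases eq_or_ne q 0 with rfl | hq0
    · simp
    have hqD : (q : ℝ) < D := by
      rw [← ENNReal.ofReal_coe_nnreal, ENNReal.ofReal_lt_ofReal_iff hD] at hq
      exact hq
    let ω : ℕ → 𝒜 × Weights K := fun k => (u k, M.normWeights D (u k))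
    have hη : 0 < -((D - q) * Real.log M.B) :=
      neg_pos.2 (mul_neg_of_pos_of_neg (sub_pos.2 hqD) (Real.log_neg M.B_pos M.B_lt_one))
    -- the sums are `o(n)`, whereas `len ^ (D - q)` decays exponentially
    have hev : ∀ᶠ n : ℕ in atTop,
        Real.exp (n * ((D - q) * Real.log M.B) - ∑ k ∈ Finset.range n, M.logSum D (u k)) ≤ 1 := by
      filter_upwards [h.eventually (lt_mem_nhds (neg_lt_zero.2 hη)), eventually_gt_atTop 0]
        with n hn hn0
      rw [neg_neg, lt_div_iff₀ (Nat.cast_pos.2 hn0)] at hn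
      rw [← Real.exp_zero]
      exact Real.exp_le_exp.2 (by linarith)
    obtain ⟨C, hC⟩ := (IsBoundedUnder.bddAbove_range ⟨1, eventually_map.2 hev⟩)
    have hC' : ∀ n : ℕ, Real.exp (n * ((D - q) * Real.log M.B) -
        ∑ k ∈ Finset.range n, M.logSum D (u k)) ≤ C := fun n => hC ⟨n, rfl⟩
    refine M.le_dimH_moranSet ω (s := q) (pos_iff_ne_zero.2 hq0) (C := C)
      ((Real.exp_pos _).trans_le (hC' 0)) fun i n => ?_
    have hl := M.len_pos u i n
    rw [M.mass_eq_of_normWeight ω (fun k i => rfl)]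
    change M.len u i n ^ D * Real.exp (-∑ k ∈ Finset.range n, M.logSum D (u k)) ≤
      C * M.len u i n ^ (q : ℝ)
    calc _ = M.len u i n ^ (q : ℝ) * (M.len u i n ^ (D - q) *
          Real.exp (-∑ k ∈ Finset.range n, M.logSum D (u k))) := by
          rw [← mul_assoc, ← Real.rpow_add hl]; ring_nf
      _ ≤ M.len u i n ^ (q : ℝ) * ((M.B ^ n) ^ (D - q) *
          Real.exp (-∑ k ∈ Finset.range n, M.logSum D (u k))) := by
          have h0 : 0 ≤ D - (q : ℝ) := by linarith
          gcongr
          exact M.len_le u i n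
      _ ≤ M.len u i n ^ (q : ℝ) * C := by
          refine mul_le_mul_of_nonneg_left (le_trans (le_of_eq ?_) (hC' n))
            (Real.rpow_nonneg hl.le _)
          rw [Real.rpow_def_of_pos (pow_pos M.B_pos n), ← Real.exp_add, Real.log_pow]
          ring_nf
      _ = _ := mul_comm _ _

variable [Finite 𝒜] [MeasurableSpace 𝒜] [MeasurableSingletonClass 𝒜]
  (𝒬 : Measure 𝒜) [IsProbabilityMeasure 𝒬]

theorem ae_dimH_moranSet {D : ℝ} (hD0 : 0 < D) (hD : M.IsMoranRoot 𝒬 D) :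
    ∀ᵐ u ∂(Measure.infinitePi fun _ : ℕ => 𝒬), dimH (M.moranSet u) = ENNReal.ofReal D := by
  have hint : ∫ v, M.logSum D v ∂𝒬 = 0 := hD.2
  have hll (s : ℝ) := ae_infinitePi_tendsto_average 𝒬 (measurable_of_countable (M.logSum s))
    Integrable.of_finite
  filter_upwards [hll D, ae_all_iff.2 fun m : ℕ => hll (D + 1 / ((m : ℝ) + 1))] with u h1 h2
  rw [hint] at h1
  refine M.dimH_moranSet_eq u hD0 (fun m => ?_) h1
  have hm : (0 : ℝ) < 1 / ((m : ℝ) + 1) := by positivity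
  refine M.dimH_moranSet_le u (Real.toNNReal (D + 1 / ((m : ℝ) + 1))) ?_
    (by simpa only [Real.coe_toNNReal _ (add_pos hD0 hm).le] using h2 m)
  refine (M.integral_logSum_le 𝒬 (le_add_of_nonneg_right hm.le)).trans_lt ?_
  rw [hint, zero_add, add_sub_cancel_left]
  exact mul_neg_of_pos_of_neg hm (Real.log_neg M.B_pos M.B_lt_one)

end Hausdorff

end IFSFamily

/-! ### Concentration over blocks -/

section Concentration

variable {Ω : Type*} [MeasurableSpace Ω] (P : Measure Ω) [IsProbabilityMeasure P]

/-- Hoeffding's inequality for a block of independent copies of a bounded centred function. -/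
theorem measureReal_block_le {f : Ω → ℝ} (hf : Measurable f) {b : ℝ} (hb0 : 0 < b)
    (hb : ∀ x, |f x| ≤ b) (h0 : ∫ x, f x ∂P = 0) {ε : ℝ} (hε : 0 < ε) (n L : ℕ) :
    (Measure.infinitePi fun _ : ℕ => P).real
        {ω | ε * L ≤ |∑ k ∈ Finset.Ico n (n + L), f (ω k)|} ≤
      2 * Real.exp (-(ε ^ 2 / (2 * b ^ 2)) * L) := by
  have hmp (n : ℕ) := measurePreserving_eval_infinitePi (fun _ : ℕ => P) n
  have hcoe : (((‖b - -b‖₊ / 2) ^ 2 : NNReal) : ℝ) = b ^ 2 := by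
    have : ‖b - -b‖ = 2 * b := by rw [Real.norm_eq_abs, abs_of_pos (by linarith)]; ring
    push_cast
    rw [this]; ring
  have hexp : -(ε * L) ^ 2 / (2 * ∑ _i ∈ Finset.Ico n (n + L), b ^ 2) =
      -(ε ^ 2 / (2 * b ^ 2)) * L := by
    rcases eq_or_ne (L : ℝ) 0 with hL | hL
    · simp [hL]
    · simp only [Finset.sum_const, Nat.card_Ico, add_tsub_cancel_left, nsmul_eq_mul]
      field_simp
  have key : ∀ g : Ω → ℝ, Measurable g → (∀ x, |g x| ≤ b) → ∫ x, g x ∂P = 0 →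
      (Measure.infinitePi fun _ : ℕ => P).real
        {ω | ε * L ≤ ∑ k ∈ Finset.Ico n (n + L), g (ω k)} ≤
        Real.exp (-(ε ^ 2 / (2 * b ^ 2)) * L) := by
    intro g hg hgb hg0
    have hsub (k : ℕ) : ProbabilityTheory.HasSubgaussianMGF (fun ω : ℕ → Ω => g (ω k))
        ((‖b - -b‖₊ / 2) ^ 2) (Measure.infinitePi fun _ : ℕ => P) := by
      refine ProbabilityTheory.hasSubgaussianMGF_of_mem_Icc_of_integral_eq_zero
        (hg.comp (hmp k).measurable).aemeasurable
        (ae_of_all _ fun ω => abs_le.1 (hgb (ω k))) ?_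
      rw [← (hmp k).map_eq, integral_map (hmp k).measurable.aemeasurable
        hg.aestronglyMeasurable] at hg0
      exact hg0
    have h1 := ProbabilityTheory.HasSubgaussianMGF.measure_sum_ge_le_of_iIndepFun
      (ProbabilityTheory.iIndepFun_infinitePi (P := fun _ : ℕ => P) (X := fun _ => g) fun _ => hg)
      (s := Finset.Ico n (n + L)) (fun k _ => hsub k) (ε := ε * L) (by positivity)
    refine h1.trans_eq ?_
    rw [NNReal.coe_sum]
    simp only [hcoe]
    rw [hexp]
  refine (measureReal_mono (s₂ := {ω | ε * L ≤ ∑ k ∈ Finset.Ico n (n + L), f (ω k)} ∪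
    {ω | ε * L ≤ ∑ k ∈ Finset.Ico n (n + L), -f (ω k)}) fun ω hω => ?_).trans
    ((measureReal_union_le _ _).trans ?_)
  · rw [Set.mem_ofPred_eq, le_abs] at hω
    rcases hω with h | h
    · exact Or.inl h
    · refine Or.inr ?_
      rwa [Set.mem_ofPred_eq, Finset.sum_neg_distrib]
  · rw [two_mul]
    exact add_le_add (key f hf hb h0)
      (key (fun x => -f x) hf.neg (by simpa using hb) (by rw [integral_neg, h0, neg_zero]))

/-- Almost surely, the average over every block `[n, n + L)` with `L ≥ c log (n + 1)` and `n` large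
is small: the failure probabilities are summable over the pairs `(n, L)`. -/
theorem ae_block_average_le {f : Ω → ℝ} (hf : Measurable f) {b : ℝ} (hb0 : 0 < b)
    (hb : ∀ x, |f x| ≤ b) (h0 : ∫ x, f x ∂P = 0) {ε : ℝ} (hε : 0 < ε) :
    ∃ c : ℝ, 0 < c ∧ ∀ᵐ ω ∂(Measure.infinitePi fun _ : ℕ => P), ∃ n₀ : ℕ, ∀ n ≥ n₀, ∀ L : ℕ,
      c * Real.log (n + 1) ≤ L →
        |∑ k ∈ Finset.range (n + L), f (ω k) - ∑ k ∈ Finset.range n, f (ω k)| ≤ ε * L := by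
  set κ := ε ^ 2 / (2 * b ^ 2)
  have hκ : 0 < κ := by positivity
  -- with this constant, `exp (-κ L) ≤ exp (-κ L / 2) * (n + 1) ^ (-2)` when `c log (n + 1) ≤ L`
  refine ⟨4 / κ, by positivity, ?_⟩
  let s : ℕ × ℕ → Set (ℕ → Ω) := fun q =>
    {ω | 4 / κ * Real.log (q.1 + 1) ≤ q.2 ∧
      ε * q.2 ≤ |∑ k ∈ Finset.Ico q.1 (q.1 + q.2), f (ω k)|}
  have hbound (q : ℕ × ℕ) : (Measure.infinitePi fun _ : ℕ => P) (s q) ≤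
      ENNReal.ofReal ((1 / ((q.1 : ℝ) + 1) ^ 2) * (2 * Real.exp (-(κ / 2)) ^ q.2)) := by
    by_cases hq : 4 / κ * Real.log (q.1 + 1) ≤ q.2
    · rw [← ofReal_measureReal]
      refine ENNReal.ofReal_le_ofReal ((measureReal_mono fun ω hω => hω.2).trans
        ((measureReal_block_le P hf hb0 hb h0 hε q.1 q.2).trans ?_))
      have hn : (0 : ℝ) < (q.1 : ℝ) + 1 := by positivity
      have h1 : (1 / ((q.1 : ℝ) + 1) ^ 2) = Real.exp (-(2 * Real.log (q.1 + 1))) := by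
        rw [Real.exp_neg, one_div, two_mul, Real.exp_add, Real.exp_log hn, sq]
      rw [h1, ← Real.exp_nat_mul, mul_left_comm, ← Real.exp_add]
      refine mul_le_mul_of_nonneg_left (Real.exp_le_exp.2 ?_) two_pos.le
      rw [div_mul_eq_mul_div, div_le_iff₀ hκ] at hq
      change -κ * _ ≤ _
      linarith
    · have : s q = ∅ := Set.eq_empty_of_forall_notMem fun ω hω => hq hω.1
      rw [this, measure_empty]
      exact zero_le
  have hsum : Summable fun q : ℕ × ℕ =>
      (1 / ((q.1 : ℝ) + 1) ^ 2) * (2 * Real.exp (-(κ / 2)) ^ q.2) := by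
    have h1 : Summable fun n : ℕ => 1 / ((n : ℝ) + 1) ^ 2 := by
      have := (summable_nat_add_iff 1).2 (Real.summable_one_div_nat_pow.2 one_lt_two)
      simpa only [Nat.cast_add, Nat.cast_one] using this
    have h2 : Summable fun L : ℕ => 2 * Real.exp (-(κ / 2)) ^ L :=
      (summable_geometric_of_lt_one (Real.exp_pos _).le
        (by rw [← Real.exp_zero]; exact Real.exp_lt_exp.2 (by linarith))).mul_left 2
    exact h1.mul_of_nonneg h2 (fun n => by positivity) (fun L => by positivity)
  have hfin := ae_finite_setOfPred_mem (μ := Measure.infinitePi fun _ : ℕ => P) (s := s)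
    (ne_top_of_le_ne_top hsum.tsum_ofReal_ne_top (ENNReal.tsum_le_tsum hbound))
  filter_upwards [hfin] with ω hω
  obtain ⟨n₁, hn₁⟩ := (hω.image Prod.fst).bddAbove
  refine ⟨n₁ + 1, fun n hn L hL => ?_⟩
  by_contra hlt
  have hmem : (n, L) ∈ {q | ω ∈ s q} := by
    refine ⟨hL, ?_⟩
    rw [Finset.sum_Ico_eq_sub _ (Nat.le_add_right n L)]
    exact (not_le.1 hlt).le
  have := hn₁ ⟨_, hmem, rfl⟩
  simp only at this
  omega

end Concentration

/-! ### `Φ`-dimensions for normalized weights -/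

namespace IFSFamily

variable {𝒜 : Type*} {K : ℕ} (M : IFSFamily 𝒜 K)

theorem τ_lt_one : M.τ < 1 := by
  have hK : (2 : ℝ) ≤ K := by exact_mod_cast M.two_le
  refine M.τ_le.trans_lt ?_
  rw [div_lt_one (by linarith)]
  linarith [M.B_pos]

theorem neg_log_A_pos : 0 < -Real.log M.A := neg_pos.2 (Real.log_neg M.A_pos M.A_lt_one)

theorem neg_log_B_pos : 0 < -Real.log M.B := neg_pos.2 (Real.log_neg M.B_pos M.B_lt_one)

variable (ω : ℕ → 𝒜 × Weights K)

/-- For normalized weights the mass of a ball of radius `R` centred in the Moran set is comparable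
with `R ^ D`, up to the error made by the Moran sums of the steps down to scale `R`. -/
theorem exists_ball_bounds {D b : ℝ} (hD : 0 ≤ D)
    (hw : ∀ k i, (ω k).2.1 i = M.normWeight D (ω k).1 i) (hb : ∀ v, |M.logSum D v| ≤ b) :
    ∃ c₁ c₂ : ℝ, 0 < c₁ ∧ 0 < c₂ ∧ ∀ (i : ℕ → Fin K) (R : ℝ), 0 < R → R ≤ M.τ →
      ∃ n, R ≤ M.τ * M.len (fun k => (ω k).1) i n ∧
        M.τ * M.A * M.len (fun k => (ω k).1) i n < R ∧
        c₁ * (R ^ D * Real.exp (-∑ k ∈ Finset.range n, M.logSum D (ω k).1)) ≤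
          (M.moranMeasure ω).real (Metric.ball (M.codingPoint (fun k => (ω k).1) i) R) ∧
        (M.moranMeasure ω).real (Metric.ball (M.codingPoint (fun k => (ω k).1) i) R) ≤
          c₂ * (R ^ D * Real.exp (-∑ k ∈ Finset.range n, M.logSum D (ω k).1)) := by
  set u : ℕ → 𝒜 := fun k => (ω k).1
  have hτ := M.τ_pos
  have hA := M.A_pos
  obtain ⟨k₀, hk₀⟩ := exists_pow_lt_of_lt_one hτ M.B_lt_one
  refine ⟨(M.A ^ (1 + k₀) / M.τ) ^ D * Real.exp (-((1 + k₀ : ℕ) * b)), (1 / (M.τ * M.A)) ^ D,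
    by positivity, by positivity, fun i R hR hRτ => ?_⟩
  obtain ⟨n, h1, h2⟩ := M.exists_len_scale u i hR hRτ
  have hl := M.len_pos u i n
  have h3 : M.τ * M.A * M.len u i n < R := by
    have := mul_le_mul_of_nonneg_left (M.le_len_add u i n 1) hτ.le
    rw [pow_one] at this
    linarith
  refine ⟨n, h1, h3, ?_, ?_⟩
  · have hlen : M.len u i (n + (1 + k₀)) < R := by
      rw [← add_assoc]
      have := M.len_add_le u i (n + 1) k₀
      nlinarith [M.len_pos u i (n + 1)]
    refine le_trans ?_ (M.le_measureReal_ball ω i hlen)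
    rw [M.mass_eq_of_normWeight ω hw, Finset.sum_range_add, neg_add, Real.exp_add]
    have hs : -((1 + k₀ : ℕ) * b) ≤ -∑ k ∈ Finset.range (1 + k₀), M.logSum D (ω (n + k)).1 := by
      refine neg_le_neg ?_
      have := Finset.sum_le_card_nsmul (Finset.range (1 + k₀)) (fun k => M.logSum D (ω (n + k)).1)
        b fun k _ => (le_abs_self _).trans (hb _)
      simpa using this
    have hr : (M.A ^ (1 + k₀) / M.τ) ^ D * R ^ D ≤ M.len u i (n + (1 + k₀)) ^ D := by
      rw [← Real.mul_rpow (by positivity) hR.le]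
      refine Real.rpow_le_rpow (by positivity) (le_trans ?_ (M.le_len_add u i n (1 + k₀))) hD
      rw [div_mul_eq_mul_div, div_le_iff₀ hτ]
      nlinarith [pow_pos hA (1 + k₀)]
    calc _ = ((M.A ^ (1 + k₀) / M.τ) ^ D * R ^ D) *
          (Real.exp (-∑ k ∈ Finset.range n, M.logSum D (ω k).1) *
            Real.exp (-((1 + k₀ : ℕ) * b))) := by ring
      _ ≤ _ := mul_le_mul hr
          (mul_le_mul_of_nonneg_left (Real.exp_le_exp.2 hs) (Real.exp_pos _).le)
          (by positivity) (Real.rpow_nonneg (M.len_pos u i _).le _)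
  · refine (M.measureReal_ball_le ω i h1).trans ?_
    rw [M.mass_eq_of_normWeight ω hw, ← mul_assoc, ← Real.mul_rpow (by positivity) hR.le]
    refine mul_le_mul_of_nonneg_right (Real.rpow_le_rpow hl.le ?_ hD) (Real.exp_pos _).le
    rw [one_div_mul_eq_div, le_div_iff₀ (by positivity)]
    linarith

/-- A large dimension function forces the steps `n ≤ N` of the scales `R` and
`r < R ^ (1 + Φ R)` apart: `N - n` exceeds any multiple of `log (n + 1)` when `R` is small. -/
theorem exists_step_gap {Φ : ℝ → ℝ} (hΦ : IsLargeDimensionFunction Φ) {c : ℝ} (hc : 0 < c)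
    (n₀ : ℕ) : ∃ C₁ : ℝ, 0 < C₁ ∧ C₁ ≤ M.τ ∧ ∀ r R : ℝ, 0 < r → r < R ^ (1 + Φ R) → 0 < R →
      R ≤ C₁ → R < 1 → ∀ (u : ℕ → 𝒜) (i : ℕ → Fin K) (n N : ℕ),
        R ≤ M.τ * M.len u i n → M.τ * M.A * M.len u i n < R →
        r ≤ M.τ * M.len u i N → M.τ * M.A * M.len u i N < r →
        n₀ ≤ n ∧ ∃ L, N = n + L ∧ c * Real.log (n + 1) ≤ L ∧
          L * -Real.log M.B ≤ 2 * Real.log (R / r) := by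
  obtain ⟨H, hH, hΦH⟩ := hΦ.large
  have hτ := M.τ_pos
  have hA := M.A_pos
  set l := -Real.log M.A with hl
  set β := -Real.log M.B with hβ
  have hl0 : 0 < l := M.neg_log_A_pos
  have hβ0 : 0 < β := M.neg_log_B_pos
  set c₁ := Real.log (1 / β + 1)
  have hc₁ : 0 < c₁ := Real.log_pos (by linarith [div_pos one_pos hβ0])
  have hlog : Tendsto (fun R : ℝ => Real.log |Real.log R|) (𝓝[>] 0) atTop :=
    Real.tendsto_log_atTop.comp (tendsto_abs_atBot_atTop.comp Real.tendsto_log_nhdsGT_zero)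
  have hpos : 0 < M.τ * M.A ^ (n₀ + 1) := by positivity
  have hev : ∀ᶠ R in 𝓝[>] (0 : ℝ), l * (c + c * c₁ + 1) ≤ H R ∧
      Φ R = H R * (Real.log |Real.log R| / |Real.log R|) ∧ 1 ≤ Real.log |Real.log R| ∧
      R < M.τ * M.A ^ (n₀ + 1) := by
    filter_upwards [hH.eventually_ge_atTop _, hΦH, hlog.eventually_ge_atTop 1,
      (gt_mem_nhds hpos).filter_mono nhdsWithin_le_nhds] with R h1 h2 h3 h4
    exact ⟨h1, h2, h3, h4⟩
  obtain ⟨C, hC0, hC⟩ := mem_nhdsGT_iff_exists_Ioc_subset.1 hev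
  refine ⟨min C M.τ, lt_min hC0 hτ, min_le_right _ _, ?_⟩
  intro r R hr hrR hR hRC hR1 u i n N hn1 hn2 hN1 hN2
  obtain ⟨hHR, hΦR, hZ, hRn⟩ := hC ⟨hR, hRC.trans (min_le_left _ _)⟩
  have hlogR : Real.log R < 0 := Real.log_neg hR hR1
  set W := |Real.log R| with hW
  set Z := Real.log W with hZdef
  have hW' : W = -Real.log R := abs_of_neg hlogR
  have hW0 : 0 < W := abs_pos.2 hlogR.ne
  have hW1 : 1 ≤ W := by
    by_contra h
    linarith [Real.log_nonpos hW0.le (not_le.1 h).le]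
  set x := Real.log (M.len u i n)
  set y := Real.log (M.len u i N)
  set T := Real.log M.τ
  have hT : T < 0 := Real.log_neg hτ M.τ_lt_one
  have hxn := M.len_pos u i n
  have hyn := M.len_pos u i N
  have e1 : Real.log R ≤ T + x := by
    rw [← Real.log_mul hτ.ne' hxn.ne']; exact Real.log_le_log hR hn1
  have e2 : T - l + x < Real.log R := by
    have := Real.log_lt_log (by positivity) hn2
    rw [Real.log_mul (by positivity) hxn.ne', Real.log_mul hτ.ne' hA.ne'] at this
    linarith
  have e3 : Real.log r ≤ T + y := by
    rw [← Real.log_mul hτ.ne' hyn.ne']; exact Real.log_le_log hr hN1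
  have e4 : T - l + y < Real.log r := by
    have := Real.log_lt_log (by positivity) hN2
    rw [Real.log_mul (by positivity) hyn.ne', Real.log_mul hτ.ne' hA.ne'] at this
    linarith
  set Q := Real.log (R / r) with hQdef
  have hQ : Q = Real.log R - Real.log r := Real.log_div hR.ne' hr.ne'
  have hQH : l * (c + c * c₁ + 1) * Z ≤ Q := by
    have h1 := Real.log_lt_log hr hrR
    rw [Real.log_rpow hR] at h1
    have h2 : Φ R * Real.log R = -(H R * Z) := by
      rw [hΦR, show Real.log R = -W by linarith]
      field_simp
    have h3 : l * (c + c * c₁ + 1) * Z ≤ H R * Z :=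
      mul_le_mul_of_nonneg_right hHR (by linarith)
    linarith
  have hcc : 0 < c * c₁ := mul_pos hc hc₁
  have hlQ : l ≤ Q := by
    have h1 : l ≤ l * (c + c * c₁ + 1) := le_mul_of_one_le_right hl0.le (by linarith)
    exact (h1.trans (le_mul_of_one_le_right (hl0.le.trans h1) hZ)).trans hQH
  have hlen_lower (m k : ℕ) : Real.log (M.len u i m) - k * l ≤ Real.log (M.len u i (m + k)) := by
    have := Real.log_le_log (by have := M.len_pos u i m; positivity) (M.le_len_add u i m k)
    rw [Real.log_mul (by positivity) (M.len_pos u i m).ne', Real.log_pow] at this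
    rw [hl]
    linarith
  have hlen_upper (m k : ℕ) : Real.log (M.len u i (m + k)) ≤ Real.log (M.len u i m) - k * β := by
    have := Real.log_le_log (M.len_pos u i _) (M.len_add_le u i m k)
    rw [Real.log_mul (pow_pos M.B_pos k).ne' (M.len_pos u i m).ne', Real.log_pow] at this
    rw [hβ]
    linarith
  have hxl : -(n * l) ≤ x := by simpa using hlen_lower 0 n
  have hxu : x ≤ -(n * β) := by simpa using hlen_upper 0 n
  constructor
  · by_contra hlt
    have h1 : Real.log R < T - (n₀ + 1) * l := by
      have := Real.log_lt_log hR hRn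
      rw [Real.log_mul hτ.ne' (by positivity), Real.log_pow] at this
      push_cast at this
      rw [hl]
      linarith
    have h2 : (n : ℝ) ≤ n₀ := by exact_mod_cast (not_le.1 hlt).le
    have h3 := mul_le_mul_of_nonneg_right h2 hl0.le
    linarith
  · have hnN : n ≤ N := by
      by_contra hlt
      have := Real.log_le_log hxn (M.len_antitone u i (not_le.1 hlt).le)
      change x ≤ y at this
      linarith
    obtain ⟨L, rfl⟩ := Nat.exists_eq_add_of_le hnN
    refine ⟨L, rfl, ?_, ?_⟩
    · have h1 : x - L * l ≤ y := hlen_lower n L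
      have h2 : l * ((c + c * c₁ + 1) * Z - 1) ≤ l * L := by linarith
      have h3 : (c + c * c₁ + 1) * Z - 1 ≤ L := le_of_mul_le_mul_left h2 hl0
      have h4 : (n : ℝ) + 1 ≤ W * (1 / β + 1) := by
        have h5 : (n : ℝ) ≤ W / β := by
          rw [le_div_iff₀ hβ0]; linarith
        have h6 : W * (1 / β + 1) = W / β + W := by ring
        linarith
      have h7 : Real.log (n + 1) ≤ Z + c₁ := by
        rw [← Real.log_mul hW0.ne' (by positivity)]
        exact Real.log_le_log (by positivity) h4
      have h8 := mul_le_mul_of_nonneg_left h7 hc.le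
      have h9 : c * c₁ ≤ c * c₁ * Z := le_mul_of_one_le_right hcc.le hZ
      linarith
    · have h1 : y ≤ x - L * β := hlen_upper n L
      linarith

theorem exists_ratio_bounds {D b : ℝ} (hD : 0 ≤ D)
    (hw : ∀ k i, (ω k).2.1 i = M.normWeight D (ω k).1 i) (hb : ∀ v, |M.logSum D v| ≤ b)
    {η c : ℝ} (hc : 0 < c) {n₀ : ℕ}
    (hS : ∀ n ≥ n₀, ∀ L : ℕ, c * Real.log (n + 1) ≤ L →
      |∑ k ∈ Finset.range (n + L), M.logSum D (ω k).1 -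
        ∑ k ∈ Finset.range n, M.logSum D (ω k).1| ≤ η * (-Real.log M.B / 2) * L)
    (hη : 0 ≤ η) {Φ : ℝ → ℝ} (hΦ : IsLargeDimensionFunction Φ) :
    ∃ C₁ C₂ C₃ : ℝ, 0 < C₁ ∧ 0 < C₂ ∧ 0 < C₃ ∧
      ∀ r R : ℝ, 0 < r → r < R ^ (1 + Φ R) → R ^ (1 + Φ R) ≤ R → R ≤ C₁ → 0 < R → R < 1 →
      ∀ x ∈ (M.moranMeasure ω).support,
        C₂ * (R / r) ^ (D - η) ≤ (M.moranMeasure ω).real (Metric.ball x R) /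
          (M.moranMeasure ω).real (Metric.ball x r) ∧
        (M.moranMeasure ω).real (Metric.ball x R) / (M.moranMeasure ω).real (Metric.ball x r) ≤
          C₃ * (R / r) ^ (D + η) := by
  obtain ⟨c₁, c₂, hc₁, hc₂, hball⟩ := M.exists_ball_bounds ω hD hw hb
  obtain ⟨C₁, hC₁, hC₁τ, hgap⟩ := M.exists_step_gap hΦ hc n₀
  refine ⟨C₁, c₁ / c₂, c₂ / c₁, hC₁, by positivity, by positivity, ?_⟩
  intro r R hr hrR hRR hRC hR hR1 x hx
  obtain ⟨i, rfl⟩ := M.support_moranMeasure_subset ω hx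
  obtain ⟨n, hn1, hn2, hn3, hn4⟩ := hball i R hR (hRC.trans hC₁τ)
  obtain ⟨N, hN1, hN2, hN3, hN4⟩ := hball i r hr ((hrR.le.trans hRR).trans (hRC.trans hC₁τ))
  obtain ⟨hn0, L, rfl, hL1, hL2⟩ := hgap r R hr hrR hR hRC hR1 _ i n N hn1 hn2 hN1 hN2
  have hSL := hS n hn0 L hL1
  set s := ∑ k ∈ Finset.range n, M.logSum D (ω k).1
  set t := ∑ k ∈ Finset.range (n + L), M.logSum D (ω k).1
  have hRr : 0 < R / r := div_pos hR hr
  have hst : |t - s| ≤ η * Real.log (R / r) := by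
    refine hSL.trans ?_
    nlinarith
  rw [abs_le] at hst
  have hsplit : R ^ D * Real.exp (-s) / (r ^ D * Real.exp (-t)) =
      (R / r) ^ D * Real.exp (t - s) := by
    rw [Real.div_rpow hR.le hr.le, show t - s = -s - -t by ring, Real.exp_sub]
    field_simp
  have hr' : 0 < r ^ D * Real.exp (-t) := by positivity
  have hR' : 0 < R ^ D * Real.exp (-s) := by positivity
  constructor
  · calc c₁ / c₂ * (R / r) ^ (D - η)
        = c₁ / c₂ * ((R / r) ^ D * Real.exp (-(η * Real.log (R / r)))) := by
          rw [sub_eq_add_neg, Real.rpow_add hRr, Real.rpow_def_of_pos hRr (-η)]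
          ring_nf
      _ ≤ c₁ / c₂ * ((R / r) ^ D * Real.exp (t - s)) := by
          gcongr
          linarith
      _ = c₁ * (R ^ D * Real.exp (-s)) / (c₂ * (r ^ D * Real.exp (-t))) := by
          rw [← hsplit, div_mul_div_comm]
      _ ≤ _ := div_le_div₀ measureReal_nonneg hn3 ((mul_pos hc₁ hr').trans_le hN3) hN4
  · calc _ ≤ c₂ * (R ^ D * Real.exp (-s)) / (c₁ * (r ^ D * Real.exp (-t))) :=
          div_le_div₀ (by positivity) hn4 (by positivity) hN3
      _ = c₂ / c₁ * ((R / r) ^ D * Real.exp (t - s)) := by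
          rw [← hsplit, div_mul_div_comm]
      _ ≤ c₂ / c₁ * ((R / r) ^ D * Real.exp (η * Real.log (R / r))) := by
          gcongr
          linarith
      _ = _ := by
          rw [Real.rpow_add hRr, Real.rpow_def_of_pos hRr η]
          ring_nf

/-- If the Moran sums have small block averages at every precision, both `Φ`-dimensions of the
measure with normalized weights are controlled by `D`. -/
theorem phiDim_bounds {D b : ℝ} (hD : 0 ≤ D)
    (hw : ∀ k i, (ω k).2.1 i = M.normWeight D (ω k).1 i) (hb : ∀ v, |M.logSum D v| ≤ b)
    (hS : ∀ m : ℕ, ∃ c : ℝ, 0 < c ∧ ∃ n₀ : ℕ, ∀ n ≥ n₀, ∀ L : ℕ, c * Real.log (n + 1) ≤ L →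
      |∑ k ∈ Finset.range (n + L), M.logSum D (ω k).1 -
        ∑ k ∈ Finset.range n, M.logSum D (ω k).1| ≤
          1 / ((m : ℝ) + 1) * (-Real.log M.B / 2) * L)
    {Φ : ℝ → ℝ} (hΦ : IsLargeDimensionFunction Φ) :
    upperPhiDim Φ (M.moranMeasure ω) ≤ D ∧ (D : EReal) ≤ lowerPhiDim Φ (M.moranMeasure ω) := by
  have hlim := tendsto_one_div_add_atTop_nhds_zero_nat (𝕜 := ℝ)
  have hcoe := (continuous_coe_real_ereal.tendsto D)
  constructor
  · have h1 := hlim.const_add D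
    rw [add_zero] at h1
    refine ge_of_tendsto' (hcoe.comp h1) fun m => ?_
    obtain ⟨c, hc, n₀, h⟩ := hS m
    obtain ⟨C₁, C₂, C₃, hC₁, -, hC₃, H⟩ := M.exists_ratio_bounds ω hD hw hb hc h (by positivity) hΦ
    exact sInf_le ⟨_, rfl, C₁, C₃, hC₁, hC₃, fun r R h1 h2 h3 h4 h5 h6 x hx =>
      (H r R h1 h2 h3 h4 h5 h6 x hx).2⟩
  · have h1 := hlim.const_sub D
    rw [sub_zero] at h1
    refine le_of_tendsto' (hcoe.comp h1) fun m => ?_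
    obtain ⟨c, hc, n₀, h⟩ := hS m
    obtain ⟨C₁, C₂, C₃, hC₁, hC₂, -, H⟩ := M.exists_ratio_bounds ω hD hw hb hc h (by positivity) hΦ
    exact le_sSup ⟨_, rfl, C₁, C₂, hC₁, hC₂, fun r R h1 h2 h3 h4 h5 h6 x hx =>
      (H r R h1 h2 h3 h4 h5 h6 x hx).1⟩

end IFSFamily

/-! ### Almost sure bounds and the uniform gap -/

namespace IFSFamily

variable {𝒜 : Type*} {K : ℕ} (M : IFSFamily 𝒜 K)

theorem ae_prod_dirac_eq_normWeight [MeasurableSpace 𝒜] (𝒬 : Measure 𝒜) [SFinite 𝒬]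
    {θ : ℝ} {p : Weights K}
    (hp : ∀ᵐ v ∂𝒬, ∀ i, p.1 i = M.normWeight θ v i) :
    ∀ᵐ x ∂(𝒬.prod (Measure.dirac p)), ∀ i, x.2.1 i = M.normWeight θ x.1 i := by
  filter_upwards [Measure.quasiMeasurePreserving_fst.ae hp,
    Measure.quasiMeasurePreserving_snd.ae (ae_dirac_eq p ▸ rfl : ∀ᵐ q ∂(Measure.dirac p), q = p)]
    with x h1 h2 i
  rw [h2, h1]

variable [Finite 𝒜] [MeasurableSpace 𝒜] [MeasurableSingletonClass 𝒜]
  (𝒬 : Measure 𝒜) [IsProbabilityMeasure 𝒬]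

/-- The addresses chosen by `m` and `m'` give points of the support whose local dimensions are
almost surely `G θ` and `G' θ`. -/
theorem ae_phiDim_bounds {ℛ : Measure (Weights K)} [IsProbabilityMeasure ℛ]
    (h : FiniteNegMoment ℛ) (θ : ℝ) :
    ∀ᵐ ω ∂(Measure.infinitePi fun _ : ℕ => 𝒬.prod ℛ), ∀ Φ : ℝ → ℝ, IsDimensionFunction Φ →
      (M.G (𝒬.prod ℛ) θ : EReal) ≤ upperPhiDim Φ (M.moranMeasure ω) ∧
      lowerPhiDim Φ (M.moranMeasure ω) ≤ (M.G' (𝒬.prod ℛ) θ : EReal) := by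
  have hm := M.measurable_m θ
  have hm' := M.measurable_m' θ
  filter_upwards [ae_infinitePi_forall _ (ae_weight_pos 𝒬 h),
    ae_infinitePi_tendsto_average _ (M.measurable_log_a hm) (M.integrable_log_a 𝒬 (ℛ := ℛ) hm),
    ae_infinitePi_tendsto_average _ (M.measurable_log_a hm') (M.integrable_log_a 𝒬 (ℛ := ℛ) hm'),
    ae_infinitePi_tendsto_average _ (measurable_log_weight hm) (integrable_log_weight 𝒬 h hm),
    ae_infinitePi_tendsto_average _ (measurable_log_weight hm') (integrable_log_weight 𝒬 h hm')]
    with ω hpos ha ha' hp hp' Φ hΦ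
  exact ⟨M.le_upperPhiDim ω (i := fun n => M.m θ (ω n)) (fun n => hpos n _)
      (M.integral_log_a_neg 𝒬 hm) hp ha hΦ,
    M.lowerPhiDim_le ω (i := fun n => M.m' θ (ω n)) (fun n => hpos n _)
      (M.integral_log_a_neg 𝒬 hm') hp' ha' hΦ⟩

theorem le_G_sub {D : ℝ} (hD : M.IsMoranRoot 𝒬 D) {ℛ : Measure (Weights K)}
    [IsProbabilityMeasure ℛ] (h : FiniteNegMoment ℛ) (i : Fin K) :
    (∫ x : 𝒜 × Weights K, |M.normWeight D x.1 i - x.2.1 i| ∂(𝒬.prod ℛ)) / -Real.log M.A ≤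
      M.G (𝒬.prod ℛ) D - D := by
  have h1 := M.integral_abs_le_of_m 𝒬 hD h i
  have h2 := M.integral_log_a_neg 𝒬 (ℛ := ℛ) (M.measurable_m D)
  have h3 := M.log_A_le_integral 𝒬 (ℛ := ℛ) (M.measurable_m D)
  have h4 : M.G (𝒬.prod ℛ) D - D = (D * ∫ x, Real.log (M.a x.1 (M.m D x)) ∂(𝒬.prod ℛ) -
      ∫ x, Real.log (x.2.1 (M.m D x)) ∂(𝒬.prod ℛ)) /
      -∫ x, Real.log (M.a x.1 (M.m D x)) ∂(𝒬.prod ℛ) := by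
    rw [G, div_sub' h2.ne, div_neg, ← neg_div]
    ring_nf
  have h5 : 0 ≤ ∫ x : 𝒜 × Weights K, |M.normWeight D x.1 i - x.2.1 i| ∂(𝒬.prod ℛ) :=
    integral_nonneg fun x => abs_nonneg _
  rw [h4]
  exact div_le_div₀ (h5.trans h1) h1 (by linarith) (by linarith)

theorem le_sub_G' {D : ℝ} (hD : M.IsMoranRoot 𝒬 D) {ℛ : Measure (Weights K)}
    [IsProbabilityMeasure ℛ] (h : FiniteNegMoment ℛ) (i : Fin K) :
    (∫ x : 𝒜 × Weights K, |M.normWeight D x.1 i - x.2.1 i| ∂(𝒬.prod ℛ)) / -Real.log M.A ≤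
      D - M.G' (𝒬.prod ℛ) D := by
  have h1 := M.integral_abs_le_of_m' 𝒬 hD h i
  have h2 := M.integral_log_a_neg 𝒬 (ℛ := ℛ) (M.measurable_m' D)
  have h3 := M.log_A_le_integral 𝒬 (ℛ := ℛ) (M.measurable_m' D)
  have h4 : D - M.G' (𝒬.prod ℛ) D = (∫ x, Real.log (x.2.1 (M.m' D x)) ∂(𝒬.prod ℛ) -
      D * ∫ x, Real.log (M.a x.1 (M.m' D x)) ∂(𝒬.prod ℛ)) /
      -∫ x, Real.log (M.a x.1 (M.m' D x)) ∂(𝒬.prod ℛ) := by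
    rw [G', sub_div' h2.ne, div_neg, ← neg_div]
    ring_nf
  have h5 : 0 ≤ ∫ x : 𝒜 × Weights K, |M.normWeight D x.1 i - x.2.1 i| ∂(𝒬.prod ℛ) :=
    integral_nonneg fun x => abs_nonneg _
  rw [h4]
  exact div_le_div₀ (h5.trans h1) h1 (by linarith) (by linarith)

/-- Two systems of positive probability with different normalized weights push `G` and `G'` away
from `D`, uniformly in the distribution of the weights. -/
theorem exists_uniform_gap {D : ℝ} (hD : M.IsMoranRoot 𝒬 D) {i : Fin K} {j j' : 𝒜}
    (hj : 0 < 𝒬 {j}) (hj' : 0 < 𝒬 {j'}) (hne : M.normWeight D j i ≠ M.normWeight D j' i) :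
    ∃ δ : ℝ, 0 < δ ∧ ∀ (ℛ : Measure (Weights K)) [IsProbabilityMeasure ℛ], FiniteNegMoment ℛ →
      δ < M.G (𝒬.prod ℛ) D - D ∧ δ < D - M.G' (𝒬.prod ℛ) D := by
  set g := min (𝒬.real {j}) (𝒬.real {j'}) * |M.normWeight D j i - M.normWeight D j' i|
  have hg : 0 < g := mul_pos
    (lt_min (ENNReal.toReal_pos hj.ne' (measure_ne_top _ _))
      (ENNReal.toReal_pos hj'.ne' (measure_ne_top _ _)))
    (abs_pos.2 (sub_ne_zero.2 hne))
  have hl := M.neg_log_A_pos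
  refine ⟨g / -Real.log M.A / 2, by positivity, fun ℛ _ h => ?_⟩
  have h1 : g / -Real.log M.A ≤
      (∫ x : 𝒜 × Weights K, |M.normWeight D x.1 i - x.2.1 i| ∂(𝒬.prod ℛ)) / -Real.log M.A :=
    div_le_div_of_nonneg_right (M.le_integral_abs_normWeight_sub 𝒬 D i hne) hl.le
  have h2 : 0 < g / -Real.log M.A := div_pos hg hl
  have h3 := M.le_G_sub 𝒬 hD h i
  have h4 := M.le_sub_G' 𝒬 hD h i
  constructor <;> linarith

theorem finiteNegMoment_dirac {p : Weights K} (hp : ∀ i, 0 < p.1 i) :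
    FiniteNegMoment (Measure.dirac p) := by
  refine ⟨1, one_pos, fun i => ?_⟩
  rw [lintegral_dirac' _ (((measurable_weight i).ennreal_ofReal).pow_const _)]
  rw [ENNReal.rpow_neg_one]
  exact ENNReal.inv_lt_top.2 (ENNReal.ofReal_pos.2 (hp i))

/-- For constant normalized weights, any measurable choice of indices gives the value `D`. -/
theorem integral_log_weight_eq {D : ℝ} (hD : M.IsMoranRoot 𝒬 D) {p : Weights K}
    (hp : ∀ᵐ v ∂𝒬, ∀ i, p.1 i = M.normWeight D v i) {σ : 𝒜 × Weights K → Fin K}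
    (hσ : Measurable σ) :
    ∫ x, Real.log (x.2.1 (σ x)) ∂(𝒬.prod (Measure.dirac p)) =
      D * ∫ x, Real.log (M.a x.1 (σ x)) ∂(𝒬.prod (Measure.dirac p)) := by
  have hae := M.ae_prod_dirac_eq_normWeight 𝒬 hp
  have h1 := (M.integrable_log_a 𝒬 (ℛ := Measure.dirac p) hσ).const_mul D
  have h2 : Integrable (fun x : 𝒜 × Weights K => M.logSum D x.1) (𝒬.prod (Measure.dirac p)) :=
    (Integrable.of_finite (μ := 𝒬) (f := M.logSum D)).comp_fst _
  have h3 : ∫ v, M.logSum D v ∂𝒬 = 0 := hD.2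
  calc _ = ∫ x : 𝒜 × Weights K, (D * Real.log (M.a x.1 (σ x)) - M.logSum D x.1)
        ∂(𝒬.prod (Measure.dirac p)) := by
        refine integral_congr_ae ?_
        filter_upwards [hae] with x hx
        rw [hx, log_normWeight, logSum]
    _ = _ := by
        rw [integral_sub h1 h2, integral_const_mul, integral_coord_fst 𝒬 (M.logSum D), h3, sub_zero]

/-- For constant normalized weights both `Φ`-dimensions are almost surely controlled by `D`, by
the concentration of the Moran sums over logarithmically long blocks. -/
theorem ae_phiDim_bounds_of_normWeight {D : ℝ} (hD : M.IsMoranRoot 𝒬 D) {p : Weights K}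
    (hp : ∀ᵐ v ∂𝒬, ∀ i, p.1 i = M.normWeight D v i) :
    ∀ᵐ ω ∂(Measure.infinitePi fun _ : ℕ => 𝒬.prod (Measure.dirac p)), ∀ Φ : ℝ → ℝ,
      IsLargeDimensionFunction Φ →
        upperPhiDim Φ (M.moranMeasure ω) ≤ D ∧ (D : EReal) ≤ lowerPhiDim Φ (M.moranMeasure ω) := by
  have hae := M.ae_prod_dirac_eq_normWeight 𝒬 hp
  obtain ⟨b, hb⟩ := (Set.finite_range fun v => |M.logSum D v|).bddAbove
  have hb' : ∀ v, |M.logSum D v| ≤ |b| + 1 := fun v =>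
    (hb ⟨v, rfl⟩).trans ((le_abs_self b).trans (by linarith))
  have h0 : ∫ x : 𝒜 × Weights K, M.logSum D x.1 ∂(𝒬.prod (Measure.dirac p)) = 0 :=
    (integral_coord_fst 𝒬 (M.logSum D)).trans hD.2
  have hB := M.neg_log_B_pos
  choose c hc hcae using fun m : ℕ => ae_block_average_le (𝒬.prod (Measure.dirac p))
    (measurable_coord_fst (M.logSum D)) (b := |b| + 1) (by positivity) (fun x => hb' x.1) h0
    (ε := 1 / ((m : ℝ) + 1) * (-Real.log M.B / 2)) (by positivity)
  filter_upwards [ae_infinitePi_forall _ hae, ae_all_iff.2 hcae] with ω hω hblock Φ hΦ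
  exact M.phiDim_bounds ω hD.1 hω hb' (fun m => ⟨c m, hc m, hblock m⟩) hΦ

end IFSFamily

theorem mainTheorem5 {𝒜 : Type*} [Finite 𝒜] [MeasurableSpace 𝒜] [MeasurableSingletonClass 𝒜]
    {K : ℕ} (M : IFSFamily 𝒜 K) (𝒬 : Measure 𝒜) [IsProbabilityMeasure 𝒬] :
    ∃ D : ℝ,
      -- `D` is the only solution of the dimension equation, and `dim_H F = D` almost surely
      M.IsMoranRoot 𝒬 D ∧ (∀ x : ℝ, M.IsMoranRoot 𝒬 x → x = D) ∧
      (∀ᵐ u ∂(Measure.infinitePi fun _ : ℕ => 𝒬), dimH (M.moranSet u) = ENNReal.ofReal D) ∧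
      -- (1) two IFSs with different normalized weights: a gap, uniform in the distribution `ℛ`
      ((∃ (i : Fin K) (j j' : 𝒜), 0 < 𝒬 {j} ∧ 0 < 𝒬 {j'} ∧
          M.a j i ^ D / ∑ l, M.a j l ^ D ≠ M.a j' i ^ D / ∑ l, M.a j' l ^ D) →
        ∃ δ₁ δ₂ : ℝ, 0 < δ₁ ∧ 0 < δ₂ ∧
          ∀ (ℛ : Measure (Weights K)) [IsProbabilityMeasure ℛ], FiniteNegMoment ℛ →
            δ₁ < M.G (𝒬.prod ℛ) D - D ∧ δ₂ < D - M.G' (𝒬.prod ℛ) D ∧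
            ∀ᵐ ω ∂(Measure.infinitePi fun _ : ℕ => 𝒬.prod ℛ),
              ∀ Φ : ℝ → ℝ, IsLargeDimensionFunction Φ →
                ((D + δ₁ : ℝ) : EReal) < upperPhiDim Φ (M.moranMeasure ω) ∧
                lowerPhiDim Φ (M.moranMeasure ω) < ((D - δ₂ : ℝ) : EReal)) ∧
      -- (2) no such pair: a single weight vector attains `D`
      ((¬ ∃ (i : Fin K) (j j' : 𝒜), 0 < 𝒬 {j} ∧ 0 < 𝒬 {j'} ∧
          M.a j i ^ D / ∑ l, M.a j l ^ D ≠ M.a j' i ^ D / ∑ l, M.a j' l ^ D) →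
        ∃ p : Weights K, (∀ i, 0 < p.1 i) ∧ FiniteNegMoment (Measure.dirac p) ∧
          M.G (𝒬.prod (Measure.dirac p)) D = D ∧ M.G' (𝒬.prod (Measure.dirac p)) D = D ∧
          ∀ᵐ ω ∂(Measure.infinitePi fun _ : ℕ => 𝒬.prod (Measure.dirac p)),
            ∀ Φ : ℝ → ℝ, IsLargeDimensionFunction Φ →
              upperPhiDim Φ (M.moranMeasure ω) = (D : EReal) ∧
              lowerPhiDim Φ (M.moranMeasure ω) = (D : EReal)) := by
  obtain ⟨D, hD0, hD⟩ := M.exists_isMoranRoot 𝒬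
  refine ⟨D, hD, fun x hx => IFSFamily.IsMoranRoot.eq M 𝒬 hx hD, M.ae_dimH_moranSet 𝒬 hD0 hD,
    ?_, ?_⟩
  · rintro ⟨i, j, j', hj, hj', hne⟩
    obtain ⟨δ, hδ, H⟩ := M.exists_uniform_gap 𝒬 hD hj hj' hne
    refine ⟨δ, δ, hδ, hδ, fun ℛ _ hℛ => ?_⟩
    obtain ⟨h1, h2⟩ := H ℛ hℛ
    refine ⟨h1, h2, ?_⟩
    filter_upwards [M.ae_phiDim_bounds 𝒬 hℛ D] with ω hω Φ hΦ
    obtain ⟨h3, h4⟩ := hω Φ hΦ.toIsDimensionFunction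
    exact ⟨(EReal.coe_lt_coe_iff.2 (by linarith)).trans_le h3,
      h4.trans_lt (EReal.coe_lt_coe_iff.2 (by linarith))⟩
  · intro hno
    -- a system of positive probability provides the weights
    obtain ⟨v₀, hv₀⟩ : ∃ v, 0 < 𝒬 {v} := by
      by_contra! hall
      have h1 : 𝒬 Set.univ = 0 := by
        rw [← Set.iUnion_of_singleton 𝒜]
        exact measure_iUnion_null fun v => nonpos_iff_eq_zero.1 (hall v)
      rw [measure_univ] at h1
      exact one_ne_zero h1
    have hp : ∀ᵐ v ∂𝒬, ∀ i, (M.normWeights D v₀).1 i = M.normWeight D v i := by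
      have hae : ∀ᵐ v ∂𝒬, 0 < 𝒬 {v} := by
        refine measure_mono_null (t := ⋃ v ∈ {v | 𝒬 {v} = 0}, {v}) (fun v hv => ?_)
          ((measure_biUnion_null_iff (Set.to_countable _)).2 fun v hv => hv)
        simpa using hv
      filter_upwards [hae] with v hv i
      by_contra hne
      exact hno ⟨i, v₀, v, hv₀, hv, hne⟩
    have hpos : ∀ i, 0 < (M.normWeights D v₀).1 i := fun i => M.normWeight_pos D v₀ i
    have hmom := IFSFamily.finiteNegMoment_dirac hpos
    have hG : M.G (𝒬.prod (Measure.dirac (M.normWeights D v₀))) D = D := by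
      rw [IFSFamily.G, M.integral_log_weight_eq 𝒬 hD hp (M.measurable_m D),
        mul_div_cancel_right₀ _ (M.integral_log_a_neg 𝒬 (M.measurable_m D)).ne]
    have hG' : M.G' (𝒬.prod (Measure.dirac (M.normWeights D v₀))) D = D := by
      rw [IFSFamily.G', M.integral_log_weight_eq 𝒬 hD hp (M.measurable_m' D),
        mul_div_cancel_right₀ _ (M.integral_log_a_neg 𝒬 (M.measurable_m' D)).ne]
    refine ⟨M.normWeights D v₀, hpos, hmom, hG, hG', ?_⟩
    filter_upwards [M.ae_phiDim_bounds 𝒬 hmom D, M.ae_phiDim_bounds_of_normWeight 𝒬 hD hp]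
      with ω h1 h2 Φ hΦ
    obtain ⟨h3, h4⟩ := h1 Φ hΦ.toIsDimensionFunction
    obtain ⟨h5, h6⟩ := h2 Φ hΦ
    rw [hG] at h3
    rw [hG'] at h4
    exact ⟨le_antisymm h5 h3, le_antisymm h4 h6⟩
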